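/- Let $G$ be a compact, simply connected, simple Lie group with maximal torus $T$, let $\mathfrak g\supset\mathfrak t$ be the complexified Lie algebras of $G$ and $T$, let $W$ be the Weyl group, $\mathcal W\subset\mathfrak t^*$ the weight lattice (the weights taking integral values on all coroots, i.e. the characters of $T$), and $\sigma(w)=\det w=\pm1$ the sign character. Fix a dominant chamber; let $\rho$ be half the sum of the positive roots, $\theta$ the highest root, $(\,,)$ the $W$-invariant inner product on $\mathfrak t^*$ with $(\theta,\theta)=2$, $h=(\theta,\rho)+1$ the dual Coxeter number, and $k\ge 0$ an integer (the level). Let $R(T)=\mathbb Z[\mathcal W]$ with basis $e^\lambda$ ($\lambda\in\mathcal W$), let $R(G)=R(T)^W$ be the representation ring of $G$, and put $A(e^\lambda)=\sum_{w\in W}\sigma(w)e^{w\lambda}$. Let $W_k$ be the affine Weyl group, generated by $W$ and the translation of $\mathfrak t^*$ by $(k+h)\theta$, with $\sigma(w)$ the determinant of the linear part of $w\in W_k$. Let $\Xi_k$ be the set of dominant weights $\lambda$ with $(\theta,\lambda)\le k$, and let $R_k(LG)$ be the free abelian group with basis $\{\chi_\lambda\}_{\lambda\in\Xi_k}$, the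 irreducible characters of the loop group $LG$ of level $k$. Define the additive induction maps $I:R(T)\to R(G)$ and $\bar I:R(T)\to R_k(LG)$ as follows: $I(e^\lambda)=A(e^{\lambda+\rho})/A(e^\rho)$; and $\bar I(e^\lambda)=\sigma(w)\chi_\mu$ if $\lambda+\rho=w(\mu+\rho)$ for some $w\in W_k$ and $\mu\in\Xi_k$, while $\bar I(e^\lambda)=0$ if there are no such $w,\mu$. Then: 1. $I$ and $\bar I$ are well defined. That is, $A(e^\rho)$ divides $A(e^{\lambda+\rho})$ with quotient in $R(G)$ for every $\lambda\in\mathcal W$, and $I(e^{\lambda'})=\sigma(w)I(e^\lambda)$ whenever $\lambda'+\rho=w(\lambda+\rho)$ with $w\in W$; moreover $\bar I(e^\lambda)=\chi_\lambda$ for $\lambda\in\Xi_k$, and $\bar I(e^{\lambda'})=\sigma(w)\bar I(e^\lambda)$ whenever $\lambda'+\rho=w(\lambda+\rho)$ with $w\in W_k$. 2. The kernel of $\bar I$ is the subgroup $N$ of $R(T)$ generated by the elements $e^{\lambda'}-\sigma(w)e^\lambda$ with $w\in W_k$, $\lambda'+\rho=w(\lambda+\rho)$, and the elements $e^\lambda$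 for which $w(\lambda+\rho)=\lambda+\rho$ for some $w\in W_k$ with $\sigma(w)=-1$. 3. There is a unique additive map $J:R(G)\to R_k(LG)$ with $J\circ I=\bar I$. Its kernel is $I(N)$, and this is an ideal of $R(G)$. 4. There is a unique commutative ring structure $F_k^G$ (the fusion algebra) on the additive group $R_k(LG)$ for which $J:R(G)\to F_k^G$ is a homomorphism of rings. -/

import Mathlib

/-!
The compact, simply connected, simple Lie group `G` enters through its complexified Lie algebra
`𝔤`, the Cartan subalgebra `𝔱`, and the root system of `(𝔤, 𝔱)`; the definitions below are made for
a root pairing `P` (roots in `M = 𝔱*`, coroots in `N = 𝔱`) with a base `b` (the choice of a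
dominant chamber).  Since `G` is simply connected, its unit lattice in `𝔱` is spanned by the
coroots, so the weight lattice is the lattice of all `x ∈ 𝔱*` with integral values on the coroots.
-/

namespace FusionAlgebra

noncomputable section

open RootPairing

variable {ι K M N : Type*} [Field K]
  [AddCommGroup M] [Module K M] [AddCommGroup N] [Module K N]

section Weights

variable (P : RootPairing ι K M N)

/-- The weight lattice: the `ℤ`-dual of the lattice spanned by the coroots. -/
def weightLattice : AddSubgroup M where
  carrier := {x | ∀ i, ∃ n : ℤ, P.toLinearMap x (P.coroot i) = n}
  zero_mem' := fun i => ⟨0, by simp⟩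
  add_mem' := fun {x y} hx hy i => by
    obtain ⟨m, hm⟩ := hx i
    obtain ⟨n, hn⟩ := hy i
    exact ⟨m + n, by simp [hm, hn]⟩
  neg_mem' := fun {x} hx i => by
    obtain ⟨m, hm⟩ := hx i
    exact ⟨-m, by simp [hm]⟩

theorem mem_weightLattice {x : M} :
    x ∈ weightLattice P ↔ ∀ i, ∃ n : ℤ, P.toLinearMap x (P.coroot i) = n := Iff.rfl

variable [P.IsCrystallographic]

theorem root_mem_weightLattice (i : ι) : P.root i ∈ weightLattice P := fun j => by
  obtain ⟨n, hn⟩ := P.exists_value (S := ℤ) i j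
  exact ⟨n, by simpa using hn.symm⟩

theorem reflection_mem_weightLattice (i : ι) {x : M} (hx : x ∈ weightLattice P) :
    P.reflection i x ∈ weightLattice P := by
  obtain ⟨n, hn⟩ := hx i
  have h : P.reflection i x = x - n • P.root i := by
    rw [P.reflection_apply, ← Int.cast_smul_eq_zsmul K, ← hn]
    rfl
  rw [h]
  exact sub_mem hx (zsmul_mem (root_mem_weightLattice P i) n)

theorem weylGroup_smul_mem_weightLattice (w : P.weylGroup) {x : M} (hx : x ∈ weightLattice P) :
    w • x ∈ weightLattice P := by
  obtain ⟨w, hw⟩ := w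
  induction hw using weylGroup.induction generalizing x with
  | mem i => exact reflection_mem_weightLattice P i hx
  | one => simpa using! hx
  | mul w₁ w₂ h₁ h₂ ih₁ ih₂ =>
    rw [← Submonoid.mk_mul_mk _ _ _ h₁ h₂, mul_smul]
    exact ih₁ (ih₂ hx)

/-- The action of an element of the Weyl group on the weight lattice. -/
def weylAct (w : P.weylGroup) : weightLattice P →+ weightLattice P where
  toFun x := ⟨w • (x : M), weylGroup_smul_mem_weightLattice P w x.2⟩
  map_zero' := by ext; simp
  map_add' x y := by ext; simp

/-- `R(T)`: the group ring of the weight lattice, that is, of the character group of `T`. -/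
abbrev RT : Type _ := AddMonoidAlgebra ℤ (weightLattice P)

/-- The character `e^x` of `T` given by a weight `x`, as an element of `R(T)`. -/
def chr (x : weightLattice P) : RT P := AddMonoidAlgebra.single x 1

/-- The action of an element of the Weyl group on `R(T)`. -/
def weylActRT (w : P.weylGroup) : RT P →+* RT P :=
  AddMonoidAlgebra.mapDomainRingHom ℤ (weylAct P w)

/-- `R(G) = R(T)^W`: the Weyl invariant integral linear combinations of the weights. -/
def RG : Subring (RT P) := ⨅ w : P.weylGroup, (weylActRT P w).eqLocus (RingHom.id (RT P))

/-- The additive map `R(T) → A` that takes given values on the characters `e^x`. -/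
def liftRT {A : Type*} [AddCommGroup A] (v : weightLattice P → A) : RT P →+ A where
  toFun f := f.coeff.sum fun x n => n • v x
  map_zero' := by simp
  map_add' f g := by
    rw [AddMonoidAlgebra.coeff_add]
    exact Finsupp.sum_add_index' (by simp) (by intros; rw [add_smul])

open Classical in
/-- The sign `±1` of an element of the (affine) Weyl group, through its linear part: the
determinant. -/
def detSign (f : M →ₗ[K] M) : ℤ := if LinearMap.det f = 1 then 1 else -1

/-- `A e^x = ∑_{w ∈ W} σ(w) e^{w x}`, extended additively to `R(T)`. -/
def antisymm : RT P →+ RT P :=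
  liftRT P fun x => ∑ᶠ w : P.weylGroup, detSign (P.weylGroupRootRep w) • chr P (weylAct P w x)

end Weights

section Finiteness

variable [Finite ι] (P : RootPairing ι K M N) [P.IsRootSystem]

/-- The Weyl group is finite, so that the sum in `antisymm` is a genuine one. -/
instance finite_weylGroup : Finite P.weylGroup := by
  refine Finite.of_injective (fun w : P.weylGroup => P.weylGroupToPerm w) fun v w h => ?_
  refine Subtype.ext (Equiv.weightHom_injective P (LinearEquiv.toLinearMap_injective ?_))
  refine LinearMap.ext_on_range (v := P.root) IsRootSystem.span_root_eq_top fun i => ?_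
  have hv := P.weylGroup_apply_root v i
  have hw := P.weylGroup_apply_root w i
  have h' : P.weylGroupToPerm v = P.weylGroupToPerm w := h
  rw [h', ← hw] at hv
  exact hv

end Finiteness

section Base

variable [Fintype ι] [CharZero K] {P : RootPairing ι K M N} (b : P.Base)

open Classical in
/-- Half the sum of the positive roots. -/
def rho : M := (2⁻¹ : K) • ∑ i with b.IsPos i, P.root i

theorem reflection_rho [P.IsCrystallographic] [P.IsReduced] {j : ι} (hj : j ∈ b.support) :
    P.reflection j (rho b) = rho b - P.root j := by
  classical
  have hjp : j ∈ Finset.univ.filter (fun i => b.IsPos i) := by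
    simpa using b.isPos_of_mem_support hj
  have key : ∑ i ∈ (Finset.univ.filter (fun i => b.IsPos i)).erase j, P.reflection j (P.root i)
      = ∑ i ∈ (Finset.univ.filter (fun i => b.IsPos i)).erase j, P.root i := by
    have hmem : ∀ i ∈ (Finset.univ.filter (fun i => b.IsPos i)).erase j,
        P.reflectionPerm j i ∈ (Finset.univ.filter (fun i => b.IsPos i)).erase j := by
      intro i hi
      rw [Finset.mem_erase, Finset.mem_filter] at hi ⊢
      have hp : b.IsPos (P.reflectionPerm j i) := hi.2.2.reflectionPerm hj hi.1
      refine ⟨fun h => ?_, Finset.mem_univ _, hp⟩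
      have hi' : i = P.reflectionPerm j j :=
        (P.reflectionPerm_self j i).symm.trans (congrArg (P.reflectionPerm j) h)
      have hneg : ¬ b.IsPos (P.reflectionPerm j j) := by
        have := (Base.IsPos.neg_iff_not b j).not.mpr
          (not_not.mpr (b.isPos_of_mem_support hj))
        exact this
      exact hneg (hi' ▸ hi.2.2)
    refine Finset.sum_nbij' (P.reflectionPerm j) (P.reflectionPerm j) hmem hmem ?_ ?_ ?_
    · intro i _; exact P.reflectionPerm_self j i
    · intro i _; exact P.reflectionPerm_self j i
    · intro i _; exact (P.root_reflectionPerm j i).symm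
  have h2 : P.root j = (2⁻¹ : K) • (P.root j + P.root j) := by
    rw [← two_smul K, smul_smul, inv_mul_cancel₀ two_ne_zero, one_smul]
  rw [rho, map_smul, map_sum, ← Finset.add_sum_erase _ _ hjp, key, P.reflection_apply_self,
    ← Finset.add_sum_erase _ (fun i => P.root i) hjp]
  generalize ∑ i ∈ (Finset.univ.filter (fun i => b.IsPos i)).erase j, P.root i = S
  have h3 : (2⁻¹ : K) • (P.root j + S) - P.root j =
      (2⁻¹ : K) • (P.root j + S) - (2⁻¹ : K) • (P.root j + P.root j) := by rw [← h2]
  rw [h3, ← smul_sub]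
  congr 1
  abel

theorem rho_mem_weightLattice [P.IsCrystallographic] [P.IsReduced] :
    rho b ∈ weightLattice P := by
  have hs : ∀ j ∈ b.support, P.toLinearMap (rho b) (P.coroot j) = 1 := by
    intro j hj
    have h := reflection_rho b hj
    rw [P.reflection_apply, sub_right_inj] at h
    have h' : (P.toLinearMap (rho b) (P.coroot j) - 1) • P.root j = 0 := by
      rw [sub_smul, one_smul, sub_eq_zero]
      exact h
    exact sub_eq_zero.mp ((smul_eq_zero.mp h').resolve_right (P.ne_zero j))
  intro i
  have hi := b.coroot_mem_span_int i
  generalize P.coroot i = z at hi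
  induction hi using Submodule.span_induction with
  | mem y hy =>
    obtain ⟨j, hj, rfl⟩ := hy
    exact ⟨1, by simpa using hs j hj⟩
  | zero => exact ⟨0, by simp⟩
  | add x y _ _ hx hy =>
    obtain ⟨m, hm⟩ := hx
    obtain ⟨n, hn⟩ := hy
    exact ⟨m + n, by simp [hm, hn]⟩
  | smul c x _ hx =>
    obtain ⟨m, hm⟩ := hx
    exact ⟨c * m, by simp [hm]⟩

/-- `ρ` as an element of the weight lattice. -/
def rhoW [P.IsCrystallographic] [P.IsReduced] : weightLattice P :=
  ⟨rho b, rho_mem_weightLattice b⟩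

/-- `P.root θ` is the highest root: it exceeds every root by a sum of simple roots. -/
def IsHighest (θ : ι) : Prop :=
  ∀ i, P.root θ - P.root i ∈ AddSubmonoid.closure (P.root '' b.support)

/-- A dominant weight takes values in `{0, 1, 2, …}` on the simple coroots. -/
def IsDominant (x : weightLattice P) : Prop :=
  ∀ i ∈ b.support, ∃ n : ℕ, P.toLinearMap (x : M) (P.coroot i) = n

variable (P) in
/-- The basic inner product on `𝔱*`: the multiple of the canonical Weyl invariant form for which
the root of index `θ` (to be the highest root) has square length `2`. -/
def basicForm (θ : ι) : LinearMap.BilinForm K M :=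
  (2 / P.RootForm (P.root θ) (P.root θ)) • P.RootForm

/-- The dual Coxeter number `h = (θ, ρ) + 1`. -/
def dualCoxeter (θ : ι) : K := basicForm P θ (P.root θ) (rho b) + 1

/-- The affine Weyl group `W_k`, acting on `𝔱*`: it is generated by the Weyl group (that is, by the
reflections) and by the translation by `(k + h) θ`. -/
def affineWeyl (θ : ι) (k : ℕ) : Subgroup (M ≃ᵃ[K] M) :=
  Subgroup.closure (Set.range (fun i => (P.reflection i).toAffineEquiv) ∪
    {AffineEquiv.constVAdd K M (((k : K) + dualCoxeter b θ) • P.root θ)})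

/-- `Ξ_k`: the dominant weights `x` with `(θ, x) ≤ k`. -/
def levelWeights (θ : ι) (k : ℕ) : Set (weightLattice P) :=
  {x | IsDominant b x ∧ ∃ n : ℤ, basicForm P θ (P.root θ) x = n ∧ n ≤ k}

/-- The additive group `R_k(LG)`.  The irreducible representations of `LG` of level `k` are
parametrized by their highest weights, the elements of `Ξ_k`, and `R_k(LG)` is the free abelian
group on them. -/
def Rk (θ : ι) (k : ℕ) : Type _ := levelWeights b θ k →₀ ℤ

instance instAddCommGroupRk (θ : ι) (k : ℕ) : AddCommGroup (Rk b θ k) :=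
  inferInstanceAs (AddCommGroup (levelWeights b θ k →₀ ℤ))

/-- The class in `R_k(LG)` of the irreducible representation with highest weight `x ∈ Ξ_k`. -/
def irr (θ : ι) (k : ℕ) (x : levelWeights b θ k) : Rk b θ k :=
  (Finsupp.single x 1 : levelWeights b θ k →₀ ℤ)

variable [P.IsCrystallographic] [P.IsReduced]

open Classical in
/-- The virtual character of `G` induced from the character `e^x` of `T`: the quotient
`A(e^x e^ρ) / A(e^ρ)`, an element of `R(G)` (the quotient exists for every weight `x`, and it is
unique since `R(T)` is a domain). -/
def indChar (x : weightLattice P) : RG P :=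
  if h : ∃ f : RG P, antisymm P (chr P (rhoW b)) * f = antisymm P (chr P (x + rhoW b))
  then h.choose else 0

/-- The induction map `I : R(T) → R(G)`. -/
def ind : RT P →+ RG P := liftRT P (indChar b)

open Classical in
/-- Holomorphic induction to `LG` of the character `e^x` of `T`, following Borel, Weil and Bott:
it is `σ(w)` times the irreducible representation with highest weight `y`
if `x + ρ = w (y + ρ)` for some `w ∈ W_k` and `y ∈ Ξ_k`, and `0` if there are no such `w`, `y`. -/
def indLoopChar (θ : ι) (k : ℕ) (x : weightLattice P) : Rk b θ k :=
  if h : ∃ p : affineWeyl b θ k × levelWeights b θ k,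
      (x : M) + rho b = (p.1 : M ≃ᵃ[K] M) (((p.2 : weightLattice P) : M) + rho b)
  then detSign ((h.choose.1 : M ≃ᵃ[K] M).linear : M →ₗ[K] M) • irr b θ k h.choose.2
  else 0

/-- The induction map `Ī : R(T) → R_k(LG)`. -/
def indLoop (θ : ι) (k : ℕ) : RT P →+ Rk b θ k := liftRT P (indLoopChar b θ k)

/-- The subgroup of `R(T)` generated by the relations of the shifted action of `W_k`, signs
included: `e^y - σ(w) e^x` if `y + ρ = w (x + ρ)`, and `e^x` if `x + ρ` is fixed by an element of
`W_k` of sign `-1`. -/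
def affineRelations (θ : ι) (k : ℕ) : AddSubgroup (RT P) :=
  AddSubgroup.closure
    ({f | ∃ w ∈ affineWeyl b θ k, ∃ x y : weightLattice P,
        (y : M) + rho b = w ((x : M) + rho b) ∧
        f = chr P y - detSign (w.linear : M →ₗ[K] M) • chr P x} ∪
      {f | ∃ w ∈ affineWeyl b θ k, ∃ x : weightLattice P,
        (x : M) + rho b = w ((x : M) + rho b) ∧ detSign (w.linear : M →ₗ[K] M) = -1 ∧
        f = chr P x})

/-- A commutative ring structure on `R_k(LG)` with its given addition for which `J` is a
homomorphism of rings. -/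
structure IsFusionRing {θ : ι} {k : ℕ} (J : RG P →+ Rk b θ k) (F : CommRing (Rk b θ k)) :
    Prop where
  add_eq : F.toRing.toAddCommGroup = instAddCommGroupRk b θ k
  map_one : J 1 = F.one
  map_mul : ∀ f g : RG P, J (f * g) = F.mul (J f) (J g)

end Base

end

end FusionAlgebra

/-! Finite part. `A(e^x)` is antisymmetric under `W`, so divisibility by `A(e^ρ)` is needed only for
dominant `x`. If such an `x` lies on a wall, `A(e^x) = 0`. Otherwise `x = z + ρ` with `z` dominant,
and `A(e^ρ)` times the orbit sum of `z` is the sum of the `A(e^{u+ρ})` over the orbit; the terms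
with `u ≠ z` have shorter exponents, and induction on length applies
(`exists_antisymm_chr_rhoW_mul_eq`). Since `R(T)` is a domain and `A(e^ρ) ≠ 0`, the quotients are
unique, and `I` restricts to the identity on `R(G)`.

Affine part. `Ξ_k + ρ` is the set of weights in the open alcove of size `k + h`. An exchange
argument with affine roots shows that the closed alcove meets each orbit of `W_k` at most once and
that a word in the wall reflections fixing an interior point has even length
(`walk_eq_self_of_inAlcove`). This makes `Ī` well defined. Conversely, reflecting towards `ρ` brings
every weight into the closed alcove (`exists_inAlcove_walk`); if it ends on a wall, it is fixed by
an element of sign `-1`. So `Ξ_k` represents everything modulo the relations, and these span the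
kernel.

Fusion. `|W| Ī(f) = Ī(e^{-ρ} A(e^ρ f))` and `A(e^ρ f) = A(e^ρ) I(f)`, so `Ī` kills the kernel of
`I`, as its target is torsion-free. Hence `J` is the restriction of `Ī` to `R(G)`. Multiplication by
an invariant element respects the affine relations, because linear parts lie in `W`; so the kernel
of `J` is an ideal and the product descends along the surjection `J`.

As `K` carries no order, all inequalities concern the integer-valued form `weightForm`. -/

namespace FusionAlgebra

noncomputable section

open RootPairing

set_option linter.unusedSectionVars false

/-! ### Integral pairings and reflections on the weight lattice -/

section Lattice

variable {ι K M N : Type*} [Field K] [CharZero K]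
  [AddCommGroup M] [Module K M] [AddCommGroup N] [Module K N]
  (P : RootPairing ι K M N)

/-- The integral pairing of weights with the coroot of index `i`. -/
def corootPairing (i : ι) : weightLattice P →+ ℤ where
  toFun x := (x.2 i).choose
  map_zero' := by
    have h := ((0 : weightLattice P).2 i).choose_spec
    have h' : ((((0 : weightLattice P).2 i).choose : ℤ) : K) = 0 := by rw [← h]; simp
    exact_mod_cast h'
  map_add' x y := by
    have hx := (x.2 i).choose_spec
    have hy := (y.2 i).choose_spec
    have hxy := ((x + y).2 i).choose_spec
    have h' : ((((x + y).2 i).choose : ℤ) : K) = (x.2 i).choose + (y.2 i).choose := by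
      rw [← hxy, ← hx, ← hy]; simp
    exact_mod_cast h'

theorem cast_corootPairing (i : ι) (x : weightLattice P) :
    (corootPairing P i x : K) = P.toLinearMap (x : M) (P.coroot i) :=
  ((x.2 i).choose_spec).symm

theorem corootPairing_eq_iff {i : ι} {x : weightLattice P} {n : ℤ} :
    corootPairing P i x = n ↔ P.toLinearMap (x : M) (P.coroot i) = n := by
  rw [← cast_corootPairing, Int.cast_inj]

variable [P.IsCrystallographic]

/-- The root of index `i`, as a weight. -/
def rootWeight (i : ι) : weightLattice P := ⟨P.root i, root_mem_weightLattice P i⟩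

@[simp] theorem coe_rootWeight (i : ι) : (rootWeight P i : M) = P.root i := rfl

theorem rootWeight_injective : Function.Injective (rootWeight P) := fun _ _ h =>
  P.root.injective (congrArg Subtype.val h)

@[simp] theorem corootPairing_rootWeight_self (i : ι) :
    corootPairing P i (rootWeight P i) = 2 := by
  rw [corootPairing_eq_iff]; simp

/-- The reflection in the root of index `i` on the weight lattice. -/
def reflectionWeight (i : ι) : weightLattice P →+ weightLattice P where
  toFun x := x - corootPairing P i x • rootWeight P i
  map_zero' := by simp
  map_add' x y := by rw [map_add, add_smul]; abel

theorem reflectionWeight_apply (i : ι) (x : weightLattice P) :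
    reflectionWeight P i x = x - corootPairing P i x • rootWeight P i := rfl

@[simp] theorem coe_reflectionWeight (i : ι) (x : weightLattice P) :
    (reflectionWeight P i x : M) = P.reflection i (x : M) := by
  rw [reflectionWeight_apply, P.reflection_apply, AddSubgroup.coe_sub, AddSubgroup.coe_zsmul,
    coe_rootWeight, ← Int.cast_smul_eq_zsmul K, cast_corootPairing]
  rfl

theorem weylAct_ofIdx (i : ι) (x : weightLattice P) :
    weylAct P (weylGroup.ofIdx P i) x = reflectionWeight P i x := by
  apply Subtype.ext
  rw [coe_reflectionWeight]
  rfl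

@[simp] theorem reflectionWeight_reflectionWeight (i : ι) (x : weightLattice P) :
    reflectionWeight P i (reflectionWeight P i x) = x :=
  Subtype.ext (by simp)

@[simp] theorem reflectionWeight_rootWeight (i j : ι) :
    reflectionWeight P i (rootWeight P j) = rootWeight P (P.reflectionPerm i j) :=
  Subtype.ext (by simp)

theorem rootWeight_reflectionPerm_self (i : ι) :
    rootWeight P (P.reflectionPerm i i) = -rootWeight P i :=
  Subtype.ext (by simp)

theorem corootPairing_reflectionWeight (i j : ι) (x : weightLattice P) :
    corootPairing P j (reflectionWeight P i x) = corootPairing P (P.reflectionPerm i j) x := by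
  have h : (corootPairing P j (reflectionWeight P i x) : K)
      = corootPairing P (P.reflectionPerm i j) x := by
    rw [cast_corootPairing, cast_corootPairing, coe_reflectionWeight, coroot_reflectionPerm,
      P.reflection_apply, P.coreflection_apply]
    simp [mul_comm]
  exact_mod_cast h

theorem corootPairing_reflectionPerm_self (i : ι) (x : weightLattice P) :
    corootPairing P (P.reflectionPerm i i) x = -corootPairing P i x := by
  rw [← corootPairing_reflectionWeight, reflectionWeight_apply, map_sub, map_zsmul]
  simp; ring

instance instIsAddTorsionFreeWeightLattice : IsAddTorsionFree (weightLattice P) := by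
  have : Module ℚ M := Module.compHom M (algebraMap ℚ K)
  have : IsAddTorsionFree M := .of_module_rat M
  exact Function.Injective.isAddTorsionFree (weightLattice P).subtype Subtype.val_injective

end Lattice

/-! ### The invariant integral form -/

section Form

variable {ι K M N : Type*} [Field K] [CharZero K] [Fintype ι]
  [AddCommGroup M] [Module K M] [AddCommGroup N] [Module K N]
  (P : RootPairing ι K M N)

/-- The canonical invariant form on the weight lattice. -/
def weightForm (x y : weightLattice P) : ℤ := ∑ i, corootPairing P i x * corootPairing P i y

theorem weightForm_comm (x y : weightLattice P) : weightForm P x y = weightForm P y x :=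
  Finset.sum_congr rfl fun _ _ => mul_comm _ _

@[simp] theorem weightForm_add_right (x y z : weightLattice P) :
    weightForm P x (y + z) = weightForm P x y + weightForm P x z := by
  simp [weightForm, mul_add, Finset.sum_add_distrib]

@[simp] theorem weightForm_add_left (x y z : weightLattice P) :
    weightForm P (x + y) z = weightForm P x z + weightForm P y z := by
  simp [weightForm, add_mul, Finset.sum_add_distrib]

@[simp] theorem weightForm_sub_right (x y z : weightLattice P) :
    weightForm P x (y - z) = weightForm P x y - weightForm P x z := by
  simp [weightForm, mul_sub, Finset.sum_sub_distrib]

@[simp] theorem weightForm_sub_left (x y z : weightLattice P) :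
    weightForm P (x - y) z = weightForm P x z - weightForm P y z := by
  simp [weightForm, sub_mul, Finset.sum_sub_distrib]

@[simp] theorem weightForm_neg_right (x y : weightLattice P) :
    weightForm P x (-y) = -weightForm P x y := by
  simp [weightForm]

@[simp] theorem weightForm_neg_left (x y : weightLattice P) :
    weightForm P (-x) y = -weightForm P x y := by
  simp [weightForm]

@[simp] theorem weightForm_zero_right (x : weightLattice P) : weightForm P x 0 = 0 := by
  simp [weightForm]

@[simp] theorem weightForm_zsmul_right (n : ℤ) (x y : weightLattice P) :
    weightForm P x (n • y) = n * weightForm P x y := by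
  simp [weightForm, Finset.mul_sum, mul_left_comm]

@[simp] theorem weightForm_zsmul_left (n : ℤ) (x y : weightLattice P) :
    weightForm P (n • x) y = n * weightForm P x y := by
  simp [weightForm, Finset.mul_sum, mul_assoc]

theorem weightForm_self_nonneg (x : weightLattice P) : 0 ≤ weightForm P x x :=
  Finset.sum_nonneg fun _ _ => mul_self_nonneg _

/-- A vanishing sum of squares makes `x` orthogonal to all coroots, and these span. -/
theorem weightForm_self_pos [P.IsRootSystem] {x : weightLattice P} (hx : x ≠ 0) :
    0 < weightForm P x x := by
  refine lt_of_le_of_ne (weightForm_self_nonneg P x) fun h => hx ?_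
  have h0 : ∀ i, corootPairing P i x = 0 := fun i => by
    have := (Finset.sum_eq_zero_iff_of_nonneg
      (fun i _ => mul_self_nonneg (corootPairing P i x))).mp h.symm i (Finset.mem_univ _)
    simpa using this
  have h1 : P.toLinearMap (x : M) = 0 := by
    refine LinearMap.ext_on_range (v := P.coroot) IsRootSystem.span_coroot_eq_top fun i => ?_
    rw [← cast_corootPairing, h0]; simp
  exact Subtype.ext ((map_eq_zero_iff _ P.toPerfPair.injective).mp h1)

variable [P.IsCrystallographic]

theorem rootWeight_ne_zero (i : ι) : rootWeight P i ≠ 0 := fun h =>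
  P.ne_zero i (congrArg Subtype.val h)

theorem weightForm_rootWeight_self_pos [P.IsRootSystem] (i : ι) :
    0 < weightForm P (rootWeight P i) (rootWeight P i) :=
  weightForm_self_pos P (rootWeight_ne_zero P i)

@[simp] theorem weightForm_reflectionWeight (i : ι) (x y : weightLattice P) :
    weightForm P (reflectionWeight P i x) (reflectionWeight P i y) = weightForm P x y := by
  simp only [weightForm, corootPairing_reflectionWeight]
  exact Equiv.sum_comp (P.reflectionPerm i) fun j => corootPairing P j x * corootPairing P j y

theorem weightForm_reflectionWeight_left (i : ι) (x y : weightLattice P) :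
    weightForm P (reflectionWeight P i x) y = weightForm P x (reflectionWeight P i y) := by
  rw [← weightForm_reflectionWeight P i x, reflectionWeight_reflectionWeight]

/-- Invariance under `s_i`, which negates `α_i`. This is the dictionary between the form and the
coroot pairings. -/
theorem two_mul_weightForm_rootWeight (i : ι) (x : weightLattice P) :
    2 * weightForm P x (rootWeight P i) =
      corootPairing P i x * weightForm P (rootWeight P i) (rootWeight P i) := by
  have h := weightForm_reflectionWeight_left P i x (rootWeight P i)
  rw [reflectionWeight_rootWeight, rootWeight_reflectionPerm_self, reflectionWeight_apply] at h
  simp only [weightForm_sub_left, weightForm_zsmul_left, weightForm_neg_right] at h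
  linarith

theorem weightForm_weylAct (w : P.weylGroup) (x y : weightLattice P) :
    weightForm P (weylAct P w x) (weylAct P w y) = weightForm P x y := by
  obtain ⟨w, hw⟩ := w
  induction hw using weylGroup.induction generalizing x y with
  | mem i =>
    have h : ∀ z, weylAct P ⟨Equiv.reflection P i, P.reflection_mem_weylGroup i⟩ z
        = reflectionWeight P i z := weylAct_ofIdx P i
    rw [h, h, weightForm_reflectionWeight]
  | one =>
    have h : ∀ z, weylAct P ⟨1, one_mem _⟩ z = z := fun z => Subtype.ext (one_smul _ (z : M))
    rw [h, h]
  | mul w₁ w₂ h₁ h₂ ih₁ ih₂ =>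
    have h : ∀ z, weylAct P ⟨w₁ * w₂, mul_mem h₁ h₂⟩ z
        = weylAct P ⟨w₁, h₁⟩ (weylAct P ⟨w₂, h₂⟩ z) := fun z =>
      Subtype.ext (mul_smul (⟨w₁, h₁⟩ : P.weylGroup) ⟨w₂, h₂⟩ (z : M))
    rw [h, h, ih₁, ih₂]

end Form

/-! ### Determinants and signs -/

section Signs

variable {ι K M N : Type*} [Field K]
  [AddCommGroup M] [Module K M] [AddCommGroup N] [Module K N]

theorem detSign_eq_or (f : M →ₗ[K] M) : detSign f = 1 ∨ detSign f = -1 := by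
  unfold detSign; split_ifs <;> simp

theorem detSign_mul_self (f : M →ₗ[K] M) : detSign f * detSign f = 1 := by
  rcases detSign_eq_or f with h | h <;> simp [h]

@[simp] theorem detSign_id : detSign (LinearMap.id : M →ₗ[K] M) = 1 := by
  simp [detSign]

/-- `detSign` takes the value `-1` at every determinant other than `1`, so it is multiplicative only
among maps of determinant `±1`. -/
theorem detSign_comp [CharZero K] {f g : M →ₗ[K] M}
    (hf : LinearMap.det f = 1 ∨ LinearMap.det f = -1)
    (hg : LinearMap.det g = 1 ∨ LinearMap.det g = -1) :
    detSign (f ∘ₗ g) = detSign f * detSign g := by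
  have h : (-1 : K) ≠ 1 := by norm_num
  rcases hf with hf | hf <;> rcases hg with hg | hg <;> simp [detSign, hf, hg, h]

/-- A map `x ↦ x + f(x) v` has determinant `1 + f(v)`, here `1 - 2`. -/
theorem det_reflection [Finite ι] (P : RootPairing ι K M N) [P.IsRootSystem] (i : ι) :
    LinearMap.det (P.reflection i : M →ₗ[K] M) = -1 := by
  have : Module.Finite K M := ⟨⟨(Set.finite_range P.root).toFinset, by
    simp⟩⟩
  have h : (P.reflection i : M →ₗ[K] M) = LinearMap.transvection (P.coroot' i) (-P.root i) := by
    ext x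
    simp [LinearMap.transvection, P.reflection_apply, sub_eq_add_neg]
  rw [h, LinearMap.transvection.det]
  simp
  norm_num

end Signs

/-! ### The Weyl group acting on weights -/

section WeylAction

variable {ι K M N : Type*} [Field K]
  [AddCommGroup M] [Module K M] [AddCommGroup N] [Module K N]
  (P : RootPairing ι K M N) [P.IsCrystallographic]

@[simp] theorem weylAct_one (x : weightLattice P) : weylAct P 1 x = x :=
  Subtype.ext (one_smul _ (x : M))

theorem weylAct_mul (v w : P.weylGroup) (x : weightLattice P) :
    weylAct P (v * w) x = weylAct P v (weylAct P w x) :=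
  Subtype.ext (mul_smul v w (x : M))

@[simp] theorem weylAct_inv_weylAct (w : P.weylGroup) (x : weightLattice P) :
    weylAct P w⁻¹ (weylAct P w x) = x := by
  rw [← weylAct_mul, inv_mul_cancel, weylAct_one]

theorem weylAct_rootWeight (w : P.weylGroup) (i : ι) :
    weylAct P w (rootWeight P i) = rootWeight P (P.weylGroupToPerm w i) :=
  Subtype.ext (P.weylGroup_apply_root w i)

end WeylAction

/-! ### Dominant weights and the highest root -/

section Dominance

variable {ι K M N : Type*} [Field K] [CharZero K] [Fintype ι]
  [AddCommGroup M] [Module K M] [AddCommGroup N] [Module K N]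
  {P : RootPairing ι K M N} [P.IsCrystallographic] (b : P.Base)

/-- The cone of sums of simple roots, in the weight lattice. -/
def simpleCone : AddSubmonoid (weightLattice P) :=
  AddSubmonoid.closure (rootWeight P '' b.support)

theorem coe_mem_closure_iff {x : weightLattice P} :
    (x : M) ∈ AddSubmonoid.closure (P.root '' b.support) ↔ x ∈ simpleCone b := by
  have h : AddSubmonoid.closure (P.root '' b.support)
      = (simpleCone b).map (weightLattice P).subtype := by
    rw [simpleCone, AddMonoidHom.map_mclosure, Set.image_image]
    rfl
  rw [h]
  exact AddSubmonoid.mem_map_iff_mem Subtype.val_injective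

theorem IsHighest.sub_mem {θ : ι} (hθ : IsHighest b θ) (i : ι) :
    rootWeight P θ - rootWeight P i ∈ simpleCone b :=
  (coe_mem_closure_iff b).mp (hθ i)

theorem rootWeight_mem_simpleCone {i : ι} (hi : b.IsPos i) : rootWeight P i ∈ simpleCone b := by
  refine hi.induction_on_add (p := fun j => rootWeight P j ∈ simpleCone b)
    (fun j hj => AddSubmonoid.subset_closure ⟨j, hj, rfl⟩) fun j l m h hj hl => ?_
  have h' : rootWeight P m = rootWeight P j + rootWeight P l := Subtype.ext h
  rw [h']
  exact add_mem hj (AddSubmonoid.subset_closure ⟨l, hl, rfl⟩)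

theorem isPos_reflectionPerm_self_iff (i : ι) :
    b.IsPos (P.reflectionPerm i i) ↔ ¬ b.IsPos i :=
  Base.IsPos.neg_iff_not b i

theorem isDominant_iff {x : weightLattice P} :
    IsDominant b x ↔ ∀ i ∈ b.support, 0 ≤ corootPairing P i x := by
  refine forall₂_congr fun i _ => ?_
  constructor
  · rintro ⟨n, hn⟩
    have : corootPairing P i x = n := by rw [corootPairing_eq_iff, hn]; simp
    lia
  · intro h
    obtain ⟨n, hn⟩ := Int.eq_ofNat_of_zero_le h
    exact ⟨n, by rw [← cast_corootPairing, hn]; simp⟩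

variable [P.IsRootSystem]

theorem IsDominant.weightForm_nonneg {x y : weightLattice P} (hx : IsDominant b x)
    (hy : y ∈ simpleCone b) : 0 ≤ weightForm P x y := by
  induction hy using AddSubmonoid.closure_induction with
  | mem y hy =>
    obtain ⟨i, hi, rfl⟩ := hy
    have h1 := two_mul_weightForm_rootWeight P i x
    have h2 := mul_nonneg ((isDominant_iff b).mp hx i hi)
      (weightForm_rootWeight_self_pos P i).le
    lia
  | zero => simp
  | add y z _ _ hy hz => rw [weightForm_add_right]; exact add_nonneg hy hz

variable [P.IsReduced]

@[simp] theorem coe_rhoW : (rhoW b : M) = rho b := rfl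

theorem corootPairing_rhoW {i : ι} (hi : i ∈ b.support) : corootPairing P i (rhoW b) = 1 := by
  rw [corootPairing_eq_iff, coe_rhoW]
  have h := reflection_rho b hi
  rw [P.reflection_apply, sub_right_inj] at h
  have h' : (P.toLinearMap (rho b) (P.coroot i) - 1) • P.root i = 0 := by
    rw [sub_smul, one_smul, sub_eq_zero]
    exact h
  simpa using sub_eq_zero.mp ((smul_eq_zero.mp h').resolve_right (P.ne_zero i))

theorem isDominant_rhoW : IsDominant b (rhoW b) := by
  rw [isDominant_iff]
  intro i hi
  rw [corootPairing_rhoW b hi]; exact zero_le_one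

theorem weightForm_rhoW_simple_pos {i : ι} (hi : i ∈ b.support) :
    0 < weightForm P (rhoW b) (rootWeight P i) := by
  have h := two_mul_weightForm_rootWeight P i (rhoW b)
  rw [corootPairing_rhoW b hi, one_mul] at h
  have := weightForm_rootWeight_self_pos P i
  lia

theorem weightForm_rhoW_pos {i : ι} (hi : b.IsPos i) :
    0 < weightForm P (rhoW b) (rootWeight P i) := by
  refine hi.induction_on_add (p := fun j => 0 < weightForm P (rhoW b) (rootWeight P j))
    (fun j hj => weightForm_rhoW_simple_pos b hj) fun j l m h hj hl => ?_
  have h' : rootWeight P m = rootWeight P j + rootWeight P l := Subtype.ext h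
  rw [h', weightForm_add_right]
  exact add_pos hj (weightForm_rhoW_simple_pos b hl)

/-- A weight whose pairing with `ρ` is maximal in its Weyl orbit is dominant. -/
theorem isDominant_of_forall_le {x : weightLattice P}
    (hx : ∀ w : P.weylGroup,
      weightForm P (rhoW b) (weylAct P w x) ≤ weightForm P (rhoW b) x) :
    IsDominant b x := by
  rw [isDominant_iff]
  intro i hi
  -- Comparison with the simple reflection `s_i` alone suffices: it lowers the pairing with `ρ` by
  -- `⟨x, αᵢ^∨⟩ (ρ, αᵢ)`, and `(ρ, αᵢ) > 0`.
  have h := hx (weylGroup.ofIdx P i)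
  rw [weylAct_ofIdx, reflectionWeight_apply] at h
  simp only [weightForm_sub_right, weightForm_zsmul_right] at h
  exact nonneg_of_mul_nonneg_left (by lia) (weightForm_rhoW_simple_pos b hi)

theorem exists_forall_weightForm_rhoW_le (x : weightLattice P) : ∃ v : P.weylGroup,
    ∀ w : P.weylGroup,
      weightForm P (rhoW b) (weylAct P w x) ≤ weightForm P (rhoW b) (weylAct P v x) :=
  Finite.exists_max fun w : P.weylGroup => weightForm P (rhoW b) (weylAct P w x)

theorem isDominant_weylAct_of_forall_le {x : weightLattice P} {v : P.weylGroup}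
    (hv : ∀ w : P.weylGroup,
      weightForm P (rhoW b) (weylAct P w x) ≤ weightForm P (rhoW b) (weylAct P v x)) :
    IsDominant b (weylAct P v x) :=
  isDominant_of_forall_le b fun w => by rw [← weylAct_mul]; exact hv _

theorem exists_isDominant_weylAct (x : weightLattice P) :
    ∃ w : P.weylGroup, IsDominant b (weylAct P w x) := by
  obtain ⟨v, hv⟩ := exists_forall_weightForm_rhoW_le b x
  exact ⟨v, isDominant_weylAct_of_forall_le b hv⟩

variable {b} {θ : ι} (hθ : IsHighest b θ)
include hθ

/-- `θ - s_i θ = ⟨θ, αᵢ^∨⟩ αᵢ` is a sum of simple roots, so its pairing with `ρ` is nonnegative. -/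
theorem IsHighest.isDominant : IsDominant b (rootWeight P θ) := by
  rw [isDominant_iff]
  intro i hi
  have h := hθ.sub_mem b (P.reflectionPerm i θ)
  rw [← reflectionWeight_rootWeight, reflectionWeight_apply, sub_sub_cancel] at h
  have h' := (isDominant_rhoW b).weightForm_nonneg b h
  rw [weightForm_zsmul_right] at h'
  exact nonneg_of_mul_nonneg_left h' (weightForm_rhoW_simple_pos b hi)

theorem IsHighest.isPos : b.IsPos θ := by
  by_contra h
  have h1 := weightForm_rhoW_pos b ((isPos_reflectionPerm_self_iff b θ).mpr h)
  have h2 := (isDominant_rhoW b).weightForm_nonneg b (hθ.sub_mem b (P.reflectionPerm θ θ))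
  rw [rootWeight_reflectionPerm_self] at h1 h2
  simp only [weightForm_neg_right, weightForm_sub_right] at h1 h2
  lia

/-- For a dominant root `α` in the orbit, `(α, α) ≤ (α, θ) ≤ (θ, θ)`, since `θ - α` is a sum of
simple roots. -/
theorem IsHighest.weightForm_rootWeight_le (i : ι) :
    weightForm P (rootWeight P i) (rootWeight P i) ≤
      weightForm P (rootWeight P θ) (rootWeight P θ) := by
  obtain ⟨w, hw⟩ := exists_isDominant_weylAct b (rootWeight P i)
  rw [← weightForm_weylAct P w, weylAct_rootWeight] at *
  generalize P.weylGroupToPerm w i = j at *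
  have h1 := hθ.isDominant.weightForm_nonneg b (hθ.sub_mem b j)
  have h2 := hw.weightForm_nonneg b (hθ.sub_mem b j)
  simp only [weightForm_sub_right] at h1 h2
  rw [weightForm_comm P (rootWeight P j) (rootWeight P θ)] at h2
  lia

/-- `θ` is a longest root: if `⟨α, θ^∨⟩ ≥ 2`, then `|α - θ|² ≤ 0`. -/
theorem IsHighest.corootPairing_le_one {i : ι} (hi : i ≠ θ) :
    corootPairing P θ (rootWeight P i) ≤ 1 := by
  have h1 := two_mul_weightForm_rootWeight P θ (rootWeight P i)
  have h2 := weightForm_self_pos P (sub_ne_zero.mpr ((rootWeight_injective P).ne hi))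
  have h3 := hθ.weightForm_rootWeight_le i
  have h4 := weightForm_rootWeight_self_pos P θ
  simp only [weightForm_sub_right, weightForm_sub_left] at h2
  rw [weightForm_comm P (rootWeight P θ) (rootWeight P i)] at h2
  by_contra! h
  nlinarith

theorem IsHighest.corootPairing_nonneg {i : ι} (hi : b.IsPos i) :
    0 ≤ corootPairing P θ (rootWeight P i) := by
  have h1 := two_mul_weightForm_rootWeight P θ (rootWeight P i)
  have h2 := hθ.isDominant.weightForm_nonneg b (rootWeight_mem_simpleCone b hi)
  rw [weightForm_comm] at h2
  exact nonneg_of_mul_nonneg_left (by lia) (weightForm_rootWeight_self_pos P θ)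

end Dominance

/-! ### Affine roots and the exchange argument for the fundamental alcove -/

section AlcoveWalk

variable {ι K M N : Type*} [Field K] [CharZero K] [Fintype ι]
  [AddCommGroup M] [Module K M] [AddCommGroup N] [Module K N]
  {P : RootPairing ι K M N} [P.IsCrystallographic] (b : P.Base) (θ : ι) (m : ℤ)

/-- The reflections in the walls of the fundamental alcove
`{x | 0 ≤ ⟨x, αᵢ^∨⟩, ⟨x, θ^∨⟩ ≤ m}`: the simple reflections, and (for `none`) the reflection in the
affine wall. -/
def wallReflection : Option b.support → weightLattice P → weightLattice P
  | some i, x => reflectionWeight P i x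
  | none, x => reflectionWeight P θ x + m • rootWeight P θ

/-- The product of a word in the wall reflections. -/
def walk (L : List (Option b.support)) (x : weightLattice P) : weightLattice P :=
  L.foldr (wallReflection b θ m) x

@[simp] theorem walk_nil (x : weightLattice P) : walk b θ m [] x = x := rfl

@[simp] theorem walk_cons (i : Option b.support) (L : List (Option b.support))
    (x : weightLattice P) :
    walk b θ m (i :: L) x = wallReflection b θ m i (walk b θ m L x) := rfl

@[simp] theorem walk_append (L L' : List (Option b.support)) (x : weightLattice P) :
    walk b θ m (L ++ L') x = walk b θ m L (walk b θ m L' x) := by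
  simp [walk, List.foldr_append]

/-- The linear part of a wall reflection. -/
def wallLinear : Option b.support → weightLattice P →+ weightLattice P
  | some i => reflectionWeight P i
  | none => reflectionWeight P θ

/-- The action of the wall reflections on the affine roots `(i, n)`, which stand for the affine
functions `x ↦ (αᵢ, x) + n m`. -/
def wallPerm : Option b.support → ι × ℤ → ι × ℤ
  | some i, f => (P.reflectionPerm i f.1, f.2)
  | none, f => (P.reflectionPerm θ f.1, f.2 + corootPairing P θ (rootWeight P f.1))

/-- The affine root that vanishes on a wall and is positive in the alcove. -/
def wallRoot : Option b.support → ι × ℤ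
  | some i => (i, 0)
  | none => (P.reflectionPerm θ θ, 1)

/-- The action of a word in the wall reflections on the affine roots. -/
def walkPerm (L : List (Option b.support)) (f : ι × ℤ) : ι × ℤ :=
  L.foldr (wallPerm b θ) f

/-- The value of an affine root at a weight, up to a positive factor. -/
def affineValue (f : ι × ℤ) (x : weightLattice P) : ℤ :=
  2 * weightForm P x (rootWeight P f.1) +
    f.2 * m * weightForm P (rootWeight P θ) (rootWeight P θ)

/-- An affine root is positive if its value in the interior of the alcove is. -/
def IsPosAffine (f : ι × ℤ) : Prop := 0 < f.2 ∨ f.2 = 0 ∧ b.IsPos f.1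

/-- The closed fundamental alcove. -/
def InAlcove (x : weightLattice P) : Prop :=
  (∀ i ∈ b.support, 0 ≤ corootPairing P i x) ∧ corootPairing P θ x ≤ m

/-- The interior of the fundamental alcove. -/
def InAlcoveInterior (x : weightLattice P) : Prop :=
  (∀ i ∈ b.support, 0 < corootPairing P i x) ∧ corootPairing P θ x < m

/-- `y` is the reflection of `x` in the hyperplane of the affine root `f`. -/
def IsReflectionOf (f : ι × ℤ) (x y : weightLattice P) : Prop :=
  weightForm P (rootWeight P f.1) (rootWeight P f.1) • (x - y) =
    affineValue θ m f x • rootWeight P f.1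

variable {b θ m}

theorem InAlcoveInterior.inAlcove {x : weightLattice P} (hx : InAlcoveInterior b θ m x) :
    InAlcove b θ m x :=
  ⟨fun i hi => (hx.1 i hi).le, hx.2.le⟩

variable (b θ m)

theorem wallReflection_sub (i : Option b.support) (x y : weightLattice P) :
    wallReflection b θ m i x - wallReflection b θ m i y = wallLinear b θ i (x - y) := by
  cases i <;> simp [wallReflection, wallLinear]

@[simp] theorem wallReflection_wallReflection (i : Option b.support) (x : weightLattice P) :
    wallReflection b θ m i (wallReflection b θ m i x) = x := by
  cases i with
  | some i => simp [wallReflection]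
  | none =>
    simp only [wallReflection, map_add, map_zsmul, reflectionWeight_reflectionWeight,
      reflectionWeight_rootWeight, rootWeight_reflectionPerm_self]
    simp

theorem rootWeight_wallPerm (i : Option b.support) (f : ι × ℤ) :
    rootWeight P (wallPerm b θ i f).1 = wallLinear b θ i (rootWeight P f.1) := by
  cases i <;> simp [wallPerm, wallLinear]

theorem weightForm_wallLinear (i : Option b.support) (x y : weightLattice P) :
    weightForm P (wallLinear b θ i x) (wallLinear b θ i y) = weightForm P x y := by
  cases i <;> simp [wallLinear]

/-- At the affine wall, `2 (s_θ α, m θ) = -m ⟨α, θ^∨⟩ (θ, θ)`; the shift of the second coordinate in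
`wallPerm` compensates for this. -/
theorem affineValue_wallPerm (i : Option b.support) (f : ι × ℤ) (x : weightLattice P) :
    affineValue θ m (wallPerm b θ i f) (wallReflection b θ m i x) = affineValue θ m f x := by
  cases i with
  | some i =>
    simp [affineValue, wallPerm, wallReflection, ← reflectionWeight_rootWeight]
  | none =>
    have h := two_mul_weightForm_rootWeight P θ (rootWeight P f.1)
    have h' : weightForm P (rootWeight P θ) (reflectionWeight P θ (rootWeight P f.1)) =
        -weightForm P (rootWeight P θ) (rootWeight P f.1) := by
      rw [← weightForm_reflectionWeight_left, reflectionWeight_rootWeight,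
        rootWeight_reflectionPerm_self, weightForm_neg_left]
    simp only [affineValue, wallPerm, wallReflection, ← reflectionWeight_rootWeight,
      weightForm_add_left, weightForm_reflectionWeight, weightForm_zsmul_left, h']
    rw [weightForm_comm] at h
    linear_combination (-m) * h

theorem affineValue_walkPerm (L : List (Option b.support)) (f : ι × ℤ) (x : weightLattice P) :
    affineValue θ m (walkPerm b θ L f) (walk b θ m L x) = affineValue θ m f x := by
  induction L with
  | nil => rfl
  | cons i L ih => exact (affineValue_wallPerm b θ m i _ _).trans ih

theorem isReflectionOf_wallRoot (i : Option b.support) (x : weightLattice P) :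
    IsReflectionOf θ m (wallRoot b θ i) x (wallReflection b θ m i x) := by
  cases i with
  | some i =>
    have h := two_mul_weightForm_rootWeight P i x
    simp only [IsReflectionOf, wallRoot, wallReflection, reflectionWeight_apply, affineValue,
      sub_sub_cancel, zero_mul, add_zero, h]
    rw [smul_smul, mul_comm]
  | none =>
    have h := two_mul_weightForm_rootWeight P θ x
    simp only [IsReflectionOf, wallRoot, wallReflection, reflectionWeight_apply, affineValue,
      rootWeight_reflectionPerm_self, weightForm_neg_left, weightForm_neg_right, mul_neg, h]
    module

/-- Wall reflections have isometric linear parts and preserve affine values, so they carry the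
reflection relation along. -/
theorem IsReflectionOf.wallPerm {f : ι × ℤ} {x y : weightLattice P}
    (h : IsReflectionOf θ m f x y) (i : Option b.support) :
    IsReflectionOf θ m (wallPerm b θ i f) (wallReflection b θ m i x)
      (wallReflection b θ m i y) := by
  unfold IsReflectionOf at h ⊢
  rw [wallReflection_sub, affineValue_wallPerm, rootWeight_wallPerm, weightForm_wallLinear,
    ← map_zsmul, h, map_zsmul]

theorem IsReflectionOf.walkPerm {f : ι × ℤ} {x y : weightLattice P}
    (h : IsReflectionOf θ m f x y) (L : List (Option b.support)) :
    IsReflectionOf θ m (walkPerm b θ L f) (walk b θ m L x) (walk b θ m L y) := by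
  induction L with
  | nil => exact h
  | cons i L ih => exact ih.wallPerm b θ m i

variable [P.IsRootSystem]

theorem IsReflectionOf.eq {f : ι × ℤ} {x y z : weightLattice P}
    (hy : IsReflectionOf θ m f x y) (hz : IsReflectionOf θ m f x z) : y = z := by
  have h := (weightForm_rootWeight_self_pos P f.1).ne'
  have h' := zsmul_right_injective h (hy.trans hz.symm)
  exact sub_right_injective h'

theorem IsReflectionOf.eq_of_affineValue_eq_zero {f : ι × ℤ} {x y : weightLattice P}
    (hy : IsReflectionOf θ m f x y) (h : affineValue θ m f x = 0) : y = x :=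
  hy.eq θ m (by simp [IsReflectionOf, h])

/-- If a word sends the affine root of a wall to the affine root of another one, then it conjugates
the reflection in the one to the reflection in the other. -/
theorem walk_wallReflection_of_walkPerm_eq {L : List (Option b.support)}
    {i j : Option b.support} (h : walkPerm b θ L (wallRoot b θ i) = wallRoot b θ j)
    (x : weightLattice P) :
    walk b θ m L (wallReflection b θ m i x) = wallReflection b θ m j (walk b θ m L x) := by
  have h1 := (isReflectionOf_wallRoot b θ m i x).walkPerm b θ m L
  rw [h] at h1
  exact h1.eq θ m (isReflectionOf_wallRoot b θ m j _)

theorem affineValue_wallRoot_wallReflection (i : Option b.support) (x : weightLattice P) :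
    affineValue θ m (wallRoot b θ i) (wallReflection b θ m i x) =
      -affineValue θ m (wallRoot b θ i) x := by
  cases i with
  | some i =>
    have h := two_mul_weightForm_rootWeight P i x
    simp only [wallRoot, wallReflection, reflectionWeight_apply, affineValue,
      weightForm_sub_left, weightForm_zsmul_left]
    linear_combination 2 * h
  | none =>
    have h := two_mul_weightForm_rootWeight P θ x
    simp only [wallRoot, wallReflection, reflectionWeight_apply, affineValue,
      rootWeight_reflectionPerm_self, weightForm_sub_left, weightForm_add_left,
      weightForm_zsmul_left, weightForm_neg_right]
    linear_combination -2 * h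

theorem affineValue_wallRoot_pos {x : weightLattice P} (hx : InAlcoveInterior b θ m x)
    (i : Option b.support) : 0 < affineValue θ m (wallRoot b θ i) x := by
  cases i with
  | some i =>
    have h := two_mul_weightForm_rootWeight P i x
    have h' := mul_pos (hx.1 i i.2) (weightForm_rootWeight_self_pos P i)
    simp only [wallRoot, affineValue]
    lia
  | none =>
    have h := two_mul_weightForm_rootWeight P θ x
    have h' := mul_pos (sub_pos.mpr hx.2) (weightForm_rootWeight_self_pos P θ)
    simp only [wallRoot, affineValue, rootWeight_reflectionPerm_self, weightForm_neg_right]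
    linarith

variable [P.IsReduced] (hθ : IsHighest b θ)
include hθ

variable {b θ m} in
-- Both `θ - α` and `θ + α` are sums of simple roots, so `|(x, α)| ≤ (x, θ)` for dominant `x`.
theorem IsHighest.abs_weightForm_le {x : weightLattice P} (hx : InAlcove b θ m x) (i : ι) :
    |2 * weightForm P x (rootWeight P i)| ≤
      m * weightForm P (rootWeight P θ) (rootWeight P θ) := by
  have hd : IsDominant b x := (isDominant_iff b).mpr hx.1
  have h1 := hd.weightForm_nonneg b (hθ.sub_mem b i)
  have h2 := hd.weightForm_nonneg b (hθ.sub_mem b (P.reflectionPerm i i))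
  have h3 := two_mul_weightForm_rootWeight P θ x
  have h4 := mul_le_mul_of_nonneg_right hx.2 (weightForm_rootWeight_self_pos P θ).le
  simp only [rootWeight_reflectionPerm_self, weightForm_sub_right, weightForm_neg_right] at h1 h2
  rw [abs_le]
  constructor <;> linarith

variable {b θ m} in
theorem IsPosAffine.affineValue_nonneg (hm : 0 < m) {f : ι × ℤ} (hf : IsPosAffine b f)
    {x : weightLattice P} (hx : InAlcove b θ m x) : 0 ≤ affineValue θ m f x := by
  have hd : IsDominant b x := (isDominant_iff b).mpr hx.1
  have h0 := mul_pos hm (weightForm_rootWeight_self_pos P θ)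
  have h1 := (abs_le.mp (hθ.abs_weightForm_le hx f.1)).1
  rcases hf with hf | ⟨hf, hf'⟩
  · have := mul_le_mul_of_nonneg_right (Int.add_one_le_iff.mpr hf) h0.le
    simp only [affineValue]
    linarith
  · have := hd.weightForm_nonneg b (rootWeight_mem_simpleCone b hf')
    simp only [affineValue, hf]
    lia

theorem isPosAffine_wallRoot (i : Option b.support) : IsPosAffine b (wallRoot b θ i) := by
  cases i with
  | some i => exact Or.inr ⟨rfl, b.isPos_of_mem_support i.2⟩
  | none => exact Or.inl zero_lt_one

/-- A wall reflection permutes the positive affine roots other than the one of the wall. -/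
theorem eq_wallRoot_of_not_isPosAffine {f : ι × ℤ} (hf : IsPosAffine b f)
    {i : Option b.support} (hi : ¬ IsPosAffine b (wallPerm b θ i f)) : f = wallRoot b θ i := by
  obtain ⟨a, n⟩ := f
  cases i with
  | some i =>
    simp only [IsPosAffine, wallPerm, not_or, not_and] at hf hi
    obtain ⟨hn, ha⟩ := hf.resolve_left hi.1
    subst hn
    by_contra hne
    refine hi.2 rfl (ha.reflectionPerm i.2 fun h => hne ?_)
    rw [h]; rfl
  | none =>
    have hθ2 := corootPairing_rootWeight_self P θ
    have hp := hθ.isPos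
    have hneg := isPos_reflectionPerm_self_iff b θ
    have hcneg : corootPairing P θ (rootWeight P (P.reflectionPerm θ θ)) = -2 := by
      rw [rootWeight_reflectionPerm_self, map_neg, hθ2]
    simp only [IsPosAffine, wallPerm, not_or, not_and] at hf hi
    by_cases h1 : a = θ
    · subst h1; lia
    by_cases h2 : a = P.reflectionPerm θ θ
    · subst h2
      rw [P.reflectionPerm_self] at hi
      have : n = 1 := by grind
      rw [this]; rfl
    -- For `α ≠ ±θ`, `⟨α, θ^∨⟩ ≥ -1`, so `n` drops by at most one. If `n` drops from `1` to `0`,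
    -- then `⟨s_θ α, θ^∨⟩ = 1` and `s_θ α` is positive. If `n = 0` with `α` positive, then `⟨α, θ^∨⟩
    -- ≥ 0`, and when this is `0`, `s_θ` fixes `α`.
    exfalso
    have hle : ∀ j, ¬ b.IsPos j → corootPairing P θ (rootWeight P j) ≤ 0 := fun j hj => by
      have := hθ.corootPairing_nonneg ((isPos_reflectionPerm_self_iff b j).mpr hj)
      rw [rootWeight_reflectionPerm_self, map_neg] at this
      lia
    have h3 : P.reflectionPerm a a ≠ θ := fun h => h2 (rootWeight_injective P (by
      rw [rootWeight_reflectionPerm_self, ← h, rootWeight_reflectionPerm_self, neg_neg]))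
    have h4 := hθ.corootPairing_le_one h3
    rw [rootWeight_reflectionPerm_self, map_neg] at h4
    have h5 : corootPairing P θ (rootWeight P (P.reflectionPerm θ a)) =
        -corootPairing P θ (rootWeight P a) := by
      rw [← reflectionWeight_rootWeight, corootPairing_reflectionWeight,
        corootPairing_reflectionPerm_self]
    have h6 := hle (P.reflectionPerm θ a)
    rw [h5] at h6
    rcases hf with hf | ⟨rfl, hf⟩
    · have := hi.1
      exact absurd (h6 (hi.2 (by lia))) (by lia)
    · have h7 := hθ.corootPairing_nonneg hf
      have h8 : corootPairing P θ (rootWeight P a) = 0 := by lia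
      have h9 : P.reflectionPerm θ a = a := rootWeight_injective P (by
        rw [← reflectionWeight_rootWeight, reflectionWeight_apply, h8, zero_smul, sub_zero])
      exact hi.2 (by lia) (by rwa [h9])

/-- The exchange property. -/
theorem exists_walk_wallReflection_eq (L : List (Option b.support)) (i : Option b.support)
    (h : ¬ IsPosAffine b (walkPerm b θ L (wallRoot b θ i))) :
    ∃ L' : List (Option b.support), L'.length + 1 = L.length ∧
      ∀ x, walk b θ m L (wallReflection b θ m i x) = walk b θ m L' x := by
  induction L with
  | nil => exact absurd (isPosAffine_wallRoot b θ hθ i) h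
  | cons j L ih =>
    by_cases hL : IsPosAffine b (walkPerm b θ L (wallRoot b θ i))
    -- The letter `j` is where positivity is lost, so the tail carries the root of wall `i` to that
    -- of wall `j`. Moving the reflection through the tail turns `i` into `j`, which cancels the
    -- leading letter.
    · have hj := eq_wallRoot_of_not_isPosAffine b θ hθ hL h
      refine ⟨L, rfl, fun x => ?_⟩
      rw [walk_cons, walk_wallReflection_of_walkPerm_eq b θ m hj, wallReflection_wallReflection]
    · obtain ⟨L', hlen, hL'⟩ := ih hL
      exact ⟨j :: L', by simp [hlen], fun x => by rw [walk_cons, hL', walk_cons]⟩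

/-- The closed alcove is a strict fundamental domain, and words that fix an interior point are of
even length. -/
theorem walk_eq_self_of_inAlcove (hm : 0 < m) (L : List (Option b.support))
    {x : weightLattice P} (hx : InAlcove b θ m x) (hL : InAlcove b θ m (walk b θ m L x)) :
    walk b θ m L x = x ∧ (InAlcoveInterior b θ m x → Even L.length) := by
  induction hn : L.length using Nat.strong_induction_on generalizing L with
  | _ n ih =>
    rcases L.eq_nil_or_concat with rfl | ⟨L, i, rfl⟩
    · exact ⟨rfl, fun _ => by simp [← hn]⟩
    rw [List.length_concat] at hn
    simp only [List.concat_eq_append, walk_append, walk_cons, walk_nil] at hL ⊢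
    -- If the root of wall `i` stays positive under `L`, its value is nonnegative both at `x` and at
    -- `s_i x`, hence zero: `x` lies on wall `i`, and the letter can be dropped. This cannot happen
    -- at an interior point.
    by_cases h : IsPosAffine b (walkPerm b θ L (wallRoot b θ i))
    · have h1 := h.affineValue_nonneg hθ hm hL
      rw [affineValue_walkPerm, affineValue_wallRoot_wallReflection] at h1
      have h2 := (isPosAffine_wallRoot b θ hθ i).affineValue_nonneg hθ hm hx
      have h3 := (isReflectionOf_wallRoot b θ m i x).eq_of_affineValue_eq_zero θ m (by lia)
      rw [h3] at hL ⊢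
      refine ⟨(ih _ (by lia) L hL rfl).1, fun hint => ?_⟩
      have := affineValue_wallRoot_pos b θ m hint i
      lia
    -- Otherwise exchange removes two letters from the word, which preserves parity.
    · obtain ⟨L', hlen, hL'⟩ := exists_walk_wallReflection_eq b θ m hθ L i h
      rw [hL'] at hL ⊢
      obtain ⟨h1, h2⟩ := ih L'.length (by lia) L' hL rfl
      refine ⟨h1, fun hint => ?_⟩
      obtain ⟨r, hr⟩ := h2 hint
      exact ⟨r + 1, by lia⟩

end AlcoveWalk

/-! ### Weyl group elements as words in the wall reflections -/

section Words

variable {ι K M N : Type*} [Field K] [CharZero K] [Fintype ι]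
  [AddCommGroup M] [Module K M] [AddCommGroup N] [Module K N]
  {P : RootPairing ι K M N} [P.IsCrystallographic] (b : P.Base) (θ : ι) (m : ℤ)

theorem detSign_eq_neg_one_pow {f : M →ₗ[K] M} {n : ℕ} (h : LinearMap.det f = (-1) ^ n) :
    detSign f = (-1) ^ n := by
  have h' : (-1 : K) ≠ 1 := by norm_num
  rcases n.even_or_odd with hn | hn
  · rw [hn.neg_one_pow] at h ⊢
    simp [detSign, h]
  · rw [hn.neg_one_pow] at h ⊢
    simp [detSign, h, h']

theorem walk_reverse_walk (L : List (Option b.support)) (x : weightLattice P) :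
    walk b θ m L.reverse (walk b θ m L x) = x := by
  induction L generalizing x with
  | nil => rfl
  | cons i L ih => simp [ih]

theorem walk_walk_reverse (L : List (Option b.support)) (x : weightLattice P) :
    walk b θ m L (walk b θ m L.reverse x) = x := by
  simpa using walk_reverse_walk b θ m L.reverse x

variable [P.IsReduced]

/-- Every reflection is a product of an odd number of simple reflections. -/
theorem exists_walk_eq_reflectionWeight (i : ι) :
    ∃ L : List (Option b.support), Odd L.length ∧
      ∀ x, reflectionWeight P i x = walk b θ m L x := by
  refine b.induction_reflect i (p := fun i => ∃ L : List (Option b.support), Odd L.length ∧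
      ∀ x, reflectionWeight P i x = walk b θ m L x) ?_ ?_ ?_
  · rintro i ⟨L, hL, h⟩
    refine ⟨L, hL, fun x => ?_⟩
    rw [← h, reflectionWeight_apply, rootWeight_reflectionPerm_self,
      corootPairing_reflectionPerm_self, neg_smul_neg, reflectionWeight_apply]
  · intro i hi
    exact ⟨[some ⟨i, hi⟩], by simp, fun x => rfl⟩
  · rintro i j ⟨L, hL, h⟩ hj
    refine ⟨some ⟨j, hj⟩ :: (L ++ [some ⟨j, hj⟩]), ?_, fun x => ?_⟩
    · rw [List.length_cons, List.length_append]
      exact (hL.add_odd odd_one).add_odd odd_one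
    · have h' : reflectionWeight P (P.reflectionPerm j i) x
          = reflectionWeight P j (reflectionWeight P i (reflectionWeight P j x)) :=
        Subtype.ext (by
          simp only [coe_reflectionWeight]
          rw [reflection_reflectionPerm]
          rfl)
      rw [h', walk_cons, walk_append, ← h]
      rfl

variable [P.IsRootSystem]

/-- The size `m` is arbitrary, so results on the alcove can be applied to `W` with any convenient
alcove. -/
theorem exists_walk_eq_weylAct (w : P.weylGroup) :
    ∃ L : List (Option b.support), LinearMap.det (P.weylGroupRootRep w) = (-1) ^ L.length ∧
      ∀ x, weylAct P w x = walk b θ m L x := by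
  obtain ⟨w, hw⟩ := w
  induction hw using weylGroup.induction with
  | mem i =>
    obtain ⟨L, hL, h⟩ := exists_walk_eq_reflectionWeight b θ m i
    refine ⟨L, ?_, fun x => ?_⟩
    · rw [hL.neg_one_pow, ← det_reflection P i]
      rfl
    · rw [← h]
      exact weylAct_ofIdx P i x
  | one => exact ⟨[], by
      simp only [List.length_nil, pow_zero]
      exact (congrArg LinearMap.det (map_one P.weylGroupRootRep)).trans LinearMap.det_id,
      weylAct_one P⟩
  | mul w₁ w₂ h₁ h₂ ih₁ ih₂ =>
    obtain ⟨L₁, hL₁, h₁'⟩ := ih₁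
    obtain ⟨L₂, hL₂, h₂'⟩ := ih₂
    refine ⟨L₁ ++ L₂, ?_, fun x => ?_⟩
    · rw [List.length_append, pow_add, ← hL₁, ← hL₂, ← map_mul, ← map_mul]
      rfl
    · rw [walk_append, ← h₁', ← h₂', ← weylAct_mul]
      rfl

end Words

/-! ### The affine Weyl group at the shifted level -/

section AffineWeyl

variable {ι K M N : Type*} [Field K] [CharZero K] [Fintype ι]
  [AddCommGroup M] [Module K M] [AddCommGroup N] [Module K N]
  {P : RootPairing ι K M N} [P.IsCrystallographic] [P.IsReduced] [P.IsRootSystem]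
  (b : P.Base) (θ : ι) (k : ℕ)

/-- The shifted level `k + h`, as an integer. -/
def shiftedLevel : ℤ := k + (corootPairing P θ (rhoW b) + 1)

theorem rootForm_coe (x y : weightLattice P) :
    P.RootForm (x : M) (y : M) = weightForm P x y := by
  rw [P.rootForm_apply_apply, weightForm, Int.cast_sum]
  refine Finset.sum_congr rfl fun i _ => ?_
  rw [Int.cast_mul, cast_corootPairing, cast_corootPairing]
  rfl

variable (P) in
-- The normalization `(θ, θ) = 2` identifies `(θ, ·)` with the coroot of `θ`.
theorem basicForm_root_coe (x : weightLattice P) :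
    basicForm P θ (P.root θ) x = corootPairing P θ x := by
  have h1 := rootForm_coe (rootWeight P θ) (rootWeight P θ)
  have h2 := rootForm_coe (rootWeight P θ) x
  rw [coe_rootWeight] at h1 h2
  have h3 : ((weightForm P (rootWeight P θ) (rootWeight P θ) : ℤ) : K) ≠ 0 :=
    Int.cast_ne_zero.mpr (weightForm_rootWeight_self_pos P θ).ne'
  have h4 := congrArg (Int.cast : ℤ → K) (two_mul_weightForm_rootWeight P θ x)
  rw [weightForm_comm] at h4
  push_cast at h4
  rw [basicForm, LinearMap.smul_apply, LinearMap.smul_apply, h1, h2, smul_eq_mul]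
  field_simp
  rw [h4, mul_comm]

theorem cast_shiftedLevel : (shiftedLevel b θ k : K) = k + dualCoxeter b θ := by
  rw [shiftedLevel, dualCoxeter, ← coe_rhoW, basicForm_root_coe]
  push_cast
  rfl

/-- Adding `ρ` raises each simple pairing by `1` and the pairing with `θ^∨` by `h - 1`; over the
integers the weak inequalities become strict. -/
theorem mem_levelWeights_iff {x : weightLattice P} :
    x ∈ levelWeights b θ k ↔ InAlcoveInterior b θ (shiftedLevel b θ k) (x + rhoW b) := by
  have h : (∃ n : ℤ, basicForm P θ (P.root θ) x = n ∧ n ≤ k) ↔ corootPairing P θ x ≤ k := by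
    rw [basicForm_root_coe]
    simp
  refine (and_congr (isDominant_iff b) h).trans (and_congr ?_ ?_)
  · refine forall₂_congr fun i hi => ?_
    rw [map_add, corootPairing_rhoW b hi]
    lia
  · rw [map_add, shiftedLevel]
    lia

theorem coe_wallReflection_none (x : weightLattice P) :
    (wallReflection b θ (shiftedLevel b θ k) none x : M) =
      P.reflection θ (x : M) + ((k : K) + dualCoxeter b θ) • P.root θ := by
  simp only [wallReflection, AddSubgroup.coe_add, AddSubgroup.coe_zsmul, coe_rootWeight,
    coe_reflectionWeight]
  rw [← cast_shiftedLevel, Int.cast_smul_eq_zsmul]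

/-- An affine transformation acts on the weights as a given word in the wall reflections. -/
def ActsAsWalk (w : M ≃ᵃ[K] M) (L : List (Option b.support)) : Prop :=
  LinearMap.det (w.linear : M →ₗ[K] M) = (-1) ^ L.length ∧
    ∀ x : weightLattice P, w x = walk b θ (shiftedLevel b θ k) L x

variable {b θ k}

theorem ActsAsWalk.detSign_eq {w : M ≃ᵃ[K] M} {L : List (Option b.support)}
    (h : ActsAsWalk b θ k w L) : detSign (w.linear : M →ₗ[K] M) = (-1) ^ L.length :=
  detSign_eq_neg_one_pow h.1

theorem ActsAsWalk.mul {v w : M ≃ᵃ[K] M} {L L' : List (Option b.support)}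
    (hv : ActsAsWalk b θ k v L) (hw : ActsAsWalk b θ k w L') :
    ActsAsWalk b θ k (v * w) (L ++ L') := by
  refine ⟨?_, fun x => ?_⟩
  · rw [List.length_append, pow_add, ← hv.1, ← hw.1, ← LinearMap.det_comp]
    rfl
  · rw [walk_append, ← hv.2, ← hw.2]
    rfl

theorem ActsAsWalk.inv {w : M ≃ᵃ[K] M} {L : List (Option b.support)}
    (hw : ActsAsWalk b θ k w L) : ActsAsWalk b θ k w⁻¹ L.reverse := by
  refine ⟨?_, fun x => ?_⟩
  · have h : LinearMap.det (w⁻¹.linear : M →ₗ[K] M) * LinearMap.det (w.linear : M →ₗ[K] M) = 1 := by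
      rw [← LinearMap.det_comp]
      have : (w⁻¹.linear : M →ₗ[K] M) ∘ₗ (w.linear : M →ₗ[K] M) = LinearMap.id :=
        LinearMap.ext fun x => w.linear.symm_apply_apply x
      rw [this, LinearMap.det_id]
    rw [hw.1] at h
    have hs : (-1 : K) ^ L.length * (-1) ^ L.length = 1 := by
      rw [← mul_pow, neg_mul_neg, one_mul, one_pow]
    rw [List.length_reverse]
    linear_combination (-1) ^ L.length * h - LinearMap.det (w⁻¹.linear : M →ₗ[K] M) * hs
  · have h : (x : M) = w (walk b θ (shiftedLevel b θ k) L.reverse x) := by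
      rw [hw.2, walk_walk_reverse]
    nth_rewrite 1 [h]
    exact w.symm_apply_apply _

variable (b θ k)

theorem actsAsWalk_one : ActsAsWalk b θ k (1 : M ≃ᵃ[K] M) [] :=
  ⟨LinearMap.det_id.trans (pow_zero _).symm, fun _ => rfl⟩

/-- The affine transformation of a wall reflection. -/
def wallAffine : Option b.support → M ≃ᵃ[K] M
  | some i => (P.reflection i).toAffineEquiv
  | none => AffineEquiv.constVAdd K M (((k : K) + dualCoxeter b θ) • P.root θ) *
      (P.reflection θ).toAffineEquiv

theorem wallAffine_mem (i : Option b.support) :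
    wallAffine b θ k i ∈ affineWeyl b θ k := by
  cases i with
  | some i => exact Subgroup.subset_closure (Or.inl ⟨i, rfl⟩)
  | none =>
    exact mul_mem (Subgroup.subset_closure (Or.inr rfl))
      (Subgroup.subset_closure (Or.inl ⟨θ, rfl⟩))

theorem actsAsWalk_wallAffine (i : Option b.support) :
    ActsAsWalk b θ k (wallAffine b θ k i) [i] := by
  cases i with
  | some i =>
    refine ⟨?_, fun x => ?_⟩
    · rw [List.length_singleton, pow_one]
      exact det_reflection P i
    · exact (coe_reflectionWeight P i x).symm
  | none =>
    refine ⟨?_, fun x => ?_⟩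
    · rw [List.length_singleton, pow_one]
      exact det_reflection P θ
    · rw [walk_cons, walk_nil, coe_wallReflection_none, add_comm]
      rfl

theorem exists_actsAsWalk_of_mem_affineWeyl {w : M ≃ᵃ[K] M} (hw : w ∈ affineWeyl b θ k) :
    ∃ L, ActsAsWalk b θ k w L := by
  have hrefl : ∀ i, ∃ L, ActsAsWalk b θ k (P.reflection i).toAffineEquiv L := fun i => by
    obtain ⟨L, hL, h⟩ := exists_walk_eq_reflectionWeight b θ (shiftedLevel b θ k) i
    refine ⟨L, ?_, fun x => ?_⟩
    · rw [hL.neg_one_pow]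
      exact det_reflection P i
    · rw [← h]
      exact (coe_reflectionWeight P i x).symm
  induction hw using Subgroup.closure_induction with
  | mem w hw =>
    rcases hw with ⟨i, rfl⟩ | rfl
    · exact hrefl i
    · obtain ⟨L, hL⟩ := hrefl θ
      -- The translation by `(k + h) θ` is the affine wall reflection composed with `s_θ`.
      have h : AffineEquiv.constVAdd K M (((k : K) + dualCoxeter b θ) • P.root θ) =
          wallAffine b θ k none * (P.reflection θ).toAffineEquiv := by
        ext x
        simp [wallAffine]
      rw [h]
      exact ⟨_, (actsAsWalk_wallAffine b θ k none).mul hL⟩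
  | one => exact ⟨_, actsAsWalk_one b θ k⟩
  | mul v w _ _ hv hw =>
    obtain ⟨L, hL⟩ := hv
    obtain ⟨L', hL'⟩ := hw
    exact ⟨_, hL.mul hL'⟩
  | inv w _ hw =>
    obtain ⟨L, hL⟩ := hw
    exact ⟨_, hL.inv⟩

theorem exists_mem_affineWeyl_actsAsWalk (L : List (Option b.support)) :
    ∃ w ∈ affineWeyl b θ k, ActsAsWalk b θ k w L := by
  induction L with
  | nil => exact ⟨1, one_mem _, actsAsWalk_one b θ k⟩
  | cons i L ih =>
    obtain ⟨w, hw, hL⟩ := ih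
    exact ⟨_, mul_mem (wallAffine_mem b θ k i) hw, (actsAsWalk_wallAffine b θ k i).mul hL⟩

/-- The linear part of an affine Weyl transformation is a Weyl transformation. -/
theorem exists_linear_eq_of_mem_affineWeyl {w : M ≃ᵃ[K] M} (hw : w ∈ affineWeyl b θ k) :
    ∃ v : P.weylGroup, ∀ x : M, w.linear x = v • x := by
  induction hw using Subgroup.closure_induction with
  | mem w hw =>
    rcases hw with ⟨i, rfl⟩ | rfl
    · exact ⟨weylGroup.ofIdx P i, fun x => rfl⟩
    · exact ⟨1, fun x => (one_smul _ x).symm⟩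
  | one => exact ⟨1, fun x => (one_smul _ x).symm⟩
  | mul v w _ _ hv hw =>
    obtain ⟨v', hv⟩ := hv
    obtain ⟨w', hw⟩ := hw
    refine ⟨v' * w', fun x => ?_⟩
    rw [mul_smul, ← hw, ← hv]
    rfl
  | inv w _ hw =>
    obtain ⟨w', hw⟩ := hw
    refine ⟨w'⁻¹, fun x => ?_⟩
    rw [eq_inv_smul_iff, ← hw]
    exact w.linear.apply_symm_apply x

end AffineWeyl

/-! ### Descent into the closed alcove -/

section Descent

variable {ι K M N : Type*} [Field K] [CharZero K] [Fintype ι]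
  [AddCommGroup M] [Module K M] [AddCommGroup N] [Module K N]
  {P : RootPairing ι K M N} [P.IsCrystallographic] [P.IsReduced] [P.IsRootSystem]
  (b : P.Base) (θ : ι) (m : ℤ)

/-- Every weight is moved into the closed alcove by a word in the wall reflections. -/
theorem exists_inAlcove_walk (hm : corootPairing P θ (rhoW b) < m) (x : weightLattice P) :
    ∃ L, InAlcove b θ m (walk b θ m L x) := by
  induction hn : (weightForm P (x - rhoW b) (x - rhoW b)).toNat
    using Nat.strong_induction_on generalizing x with
  | _ n ih =>
    by_cases hx : InAlcove b θ m x
    · exact ⟨[], hx⟩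
    -- The descent is on the squared distance to `ρ`, an interior point by `hm`: reflecting in a
    -- wall that separates `x` from `ρ` brings `x` strictly closer.
    suffices h : ∃ i, weightForm P (wallReflection b θ m i x - rhoW b)
        (wallReflection b θ m i x - rhoW b) < weightForm P (x - rhoW b) (x - rhoW b) by
      obtain ⟨i, hi⟩ := h
      have h0 := weightForm_self_nonneg P (wallReflection b θ m i x - rhoW b)
      obtain ⟨L, hL⟩ := ih _ (by rw [← hn]; lia) (wallReflection b θ m i x) rfl
      exact ⟨L ++ [i], by simpa using hL⟩
    simp only [InAlcove, not_and_or, not_forall, not_le] at hx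
    rcases hx with ⟨i, hi, hx⟩ | hx
    · refine ⟨some ⟨i, hi⟩, ?_⟩
      have h1 := two_mul_weightForm_rootWeight P i x
      have h2 := weightForm_rhoW_simple_pos b hi
      have h3 := mul_neg_of_neg_of_pos hx h2
      simp only [wallReflection, reflectionWeight_apply, weightForm_sub_left,
        weightForm_sub_right, weightForm_zsmul_left, weightForm_zsmul_right,
        weightForm_comm P (rootWeight P i) x, weightForm_comm P (rootWeight P i) (rhoW b)]
      linear_combination 2 * h3 - corootPairing P i x * h1
    · refine ⟨none, ?_⟩
      have h1 := two_mul_weightForm_rootWeight P θ x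
      have h2 := two_mul_weightForm_rootWeight P θ (rhoW b)
      have h3 := mul_pos (mul_pos (sub_pos.mpr hx) (weightForm_rootWeight_self_pos P θ))
        (sub_pos.mpr hm)
      simp only [wallReflection, reflectionWeight_apply, weightForm_sub_left,
        weightForm_sub_right, weightForm_zsmul_left, weightForm_zsmul_right,
        weightForm_add_left, weightForm_add_right,
        weightForm_comm P (rootWeight P θ) x, weightForm_comm P (rootWeight P θ) (rhoW b)]
      linear_combination h3 + (corootPairing P θ x - m) * (h2 - h1)

theorem exists_wallReflection_eq_self_of_inAlcove {x : weightLattice P}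
    (hx : InAlcove b θ m x) (hx' : ¬ InAlcoveInterior b θ m x) :
    ∃ i, wallReflection b θ m i x = x := by
  simp only [InAlcoveInterior, not_and_or, not_forall, not_lt] at hx'
  rcases hx' with ⟨i, hi, h⟩ | h
  · refine ⟨some ⟨i, hi⟩, ?_⟩
    simp [wallReflection, reflectionWeight_apply, le_antisymm h (hx.1 i hi)]
  · refine ⟨none, ?_⟩
    simp [wallReflection, reflectionWeight_apply, le_antisymm hx.2 h]

end Descent

/-! ### The ring `R(T)` and its invariants -/

section CharacterRing

variable {ι K M N : Type*} [Field K]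
  [AddCommGroup M] [Module K M] [AddCommGroup N] [Module K N]
  (P : RootPairing ι K M N)

theorem chr_add (x y : weightLattice P) : chr P (x + y) = chr P x * chr P y := by
  rw [chr, chr, chr, AddMonoidAlgebra.single_mul_single, mul_one]

@[simp] theorem liftRT_chr {A : Type*} [AddCommGroup A] (v : weightLattice P → A)
    (x : weightLattice P) : liftRT P v (chr P x) = v x := by
  change Finsupp.sum (Finsupp.single x (1 : ℤ)) (fun x n => n • v x) = v x
  rw [Finsupp.sum_single_index (zero_smul ℤ (v x)), one_smul]

theorem coeff_chr (x : weightLattice P) : (chr P x).coeff = Finsupp.single x 1 := rfl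

theorem addHom_ext_chr {A : Type*} [AddCommGroup A] {f g : RT P →+ A}
    (h : ∀ x, f (chr P x) = g (chr P x)) : f = g := by
  refine AddMonoidAlgebra.addMonoidHom_ext fun x n => ?_
  have hn : (AddMonoidAlgebra.single x n : RT P) = n • chr P x := by
    rw [chr, AddMonoidAlgebra.smul_single, smul_eq_mul, mul_one]
  rw [hn, map_zsmul, map_zsmul, h]

instance instIsAddTorsionFreeRT : IsAddTorsionFree (RT P) :=
  AddMonoidAlgebra.coeff_injective.isAddTorsionFree
    (AddMonoidAlgebra.coeffAddEquiv (R := ℤ) (M := weightLattice P)).toAddMonoidHom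

/-- The weight lattice embeds in a rational vector space, so it has `TwoUniqueSums`, which excludes
zero divisors in its group ring. -/
theorem isDomain_RT [CharZero K] : IsDomain (RT P) := by
  have : Module ℚ M := Module.compHom M (algebraMap ℚ K)
  have : TwoUniqueSums (weightLattice P) := TwoUniqueSums.of_injective_addHom
    (weightLattice P).subtype.toAddHom Subtype.val_injective inferInstance
  infer_instance

variable [P.IsCrystallographic]

@[simp] theorem weylActRT_chr (w : P.weylGroup) (x : weightLattice P) :
    weylActRT P w (chr P x) = chr P (weylAct P w x) :=
  AddMonoidAlgebra.mapDomain_single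

theorem mem_RG_iff {f : RT P} : f ∈ RG P ↔ ∀ w, weylActRT P w f = f := by
  simp [RG, Subring.mem_iInf]

theorem weylActRT_mul_apply (v w : P.weylGroup) (f : RT P) :
    weylActRT P (v * w) f = weylActRT P v (weylActRT P w f) := by
  have h : (weylActRT P (v * w)).toAddMonoidHom =
      (weylActRT P v).toAddMonoidHom.comp (weylActRT P w).toAddMonoidHom :=
    addHom_ext_chr P fun x => by simp [weylAct_mul]
  exact DFunLike.congr_fun h f

end CharacterRing

/-! ### Antisymmetrization over the Weyl group -/

section Antisymmetrization

variable {ι K M N : Type*} [Field K] [CharZero K] [Fintype ι]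
  [AddCommGroup M] [Module K M] [AddCommGroup N] [Module K N]
  (P : RootPairing ι K M N) [P.IsCrystallographic] [P.IsRootSystem]

instance fintype_weylGroup : Fintype P.weylGroup := Fintype.ofFinite _

/-- The sign of an element of the Weyl group. -/
abbrev weylSign (w : P.weylGroup) : ℤ := detSign (P.weylGroupRootRep w)

theorem det_weylGroupRootRep (w : P.weylGroup) :
    LinearMap.det (P.weylGroupRootRep w) = 1 ∨ LinearMap.det (P.weylGroupRootRep w) = -1 := by
  obtain ⟨w, hw⟩ := w
  induction hw using weylGroup.induction with
  | mem i => exact Or.inr (det_reflection P i)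
  | one => exact Or.inl LinearMap.det_id
  | mul w₁ w₂ h₁ h₂ ih₁ ih₂ =>
    have h : LinearMap.det (P.weylGroupRootRep ⟨w₁ * w₂, mul_mem h₁ h₂⟩) =
        LinearMap.det (P.weylGroupRootRep ⟨w₁, h₁⟩) *
          LinearMap.det (P.weylGroupRootRep ⟨w₂, h₂⟩) := by
      rw [← map_mul, ← map_mul]
      rfl
    rw [h]
    rcases ih₁ with h₁ | h₁ <;> rcases ih₂ with h₂ | h₂ <;> simp [h₁, h₂]

theorem weylSign_mul (v w : P.weylGroup) : weylSign P (v * w) = weylSign P v * weylSign P w := by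
  rw [weylSign, map_mul]
  exact detSign_comp (det_weylGroupRootRep P v) (det_weylGroupRootRep P w)

@[simp] theorem weylSign_one : weylSign P 1 = 1 := by
  rw [weylSign, map_one]
  exact detSign_id

theorem weylSign_ofIdx (i : ι) : weylSign P (weylGroup.ofIdx P i) = -1 := by
  have h : LinearMap.det (P.weylGroupRootRep (weylGroup.ofIdx P i)) = (-1) ^ 1 := by
    rw [pow_one]
    exact det_reflection P i
  exact detSign_eq_neg_one_pow h

theorem antisymm_eq_sum (f : RT P) :
    antisymm P f = ∑ w, weylSign P w • weylActRT P w f := by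
  have h : antisymm P = ∑ w, weylSign P w • (weylActRT P w).toAddMonoidHom := by
    refine addHom_ext_chr P fun x => ?_
    rw [antisymm, liftRT_chr, finsum_eq_sum_of_fintype, AddMonoidHom.finsetSum_apply]
    simp
  rw [h, AddMonoidHom.finsetSum_apply]
  rfl

variable {P} in
theorem antisymm_mul_of_mem_RG {g : RT P} (hg : g ∈ RG P) (f : RT P) :
    antisymm P (g * f) = g * antisymm P f := by
  simp only [antisymm_eq_sum, Finset.mul_sum, map_mul, (mem_RG_iff P).mp hg, mul_smul_comm]

theorem antisymm_weylActRT (w : P.weylGroup) (f : RT P) :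
    antisymm P (weylActRT P w f) = weylSign P w • antisymm P f := by
  rw [antisymm_eq_sum, antisymm_eq_sum, Finset.smul_sum]
  refine Fintype.sum_equiv (Equiv.mulRight w) _ _ fun v => ?_
  rw [Equiv.coe_mulRight, weylActRT_mul_apply, weylSign_mul, smul_smul, mul_left_comm,
    detSign_mul_self, mul_one]

theorem antisymm_chr_weylAct (w : P.weylGroup) (x : weightLattice P) :
    antisymm P (chr P (weylAct P w x)) = weylSign P w • antisymm P (chr P x) := by
  rw [← weylActRT_chr, antisymm_weylActRT]

/-- `A e^x` vanishes if `x` lies on a wall. -/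
theorem antisymm_chr_eq_zero {x : weightLattice P} {i : ι} (h : corootPairing P i x = 0) :
    antisymm P (chr P x) = 0 := by
  have h1 := antisymm_chr_weylAct P (weylGroup.ofIdx P i) x
  rw [weylAct_ofIdx, reflectionWeight_apply, h, zero_smul, sub_zero, weylSign_ofIdx,
    neg_one_smul] at h1
  exact self_eq_neg.mp h1

end Antisymmetrization

/-! ### Divisibility by `A(e^ρ)` and the map `I` -/

section CharacterFormula

variable {ι K M N : Type*} [Field K] [CharZero K] [Fintype ι]
  [AddCommGroup M] [Module K M] [AddCommGroup N] [Module K N]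
  {P : RootPairing ι K M N} [P.IsCrystallographic] [P.IsReduced] [P.IsRootSystem]
  {b : P.Base} {θ : ι} (hθ : IsHighest b θ)
include hθ

theorem IsHighest.corootPairing_rhoW_pos : 0 < corootPairing P θ (rhoW b) := by
  have h1 := two_mul_weightForm_rootWeight P θ (rhoW b)
  have h2 := weightForm_rhoW_pos b hθ.isPos
  exact pos_of_mul_pos_left (by lia) (weightForm_rootWeight_self_pos P θ).le

/-- `ρ` is interior to the alcove of size `⟨ρ, θ^∨⟩ + 1`, so words fixing it are even. -/
theorem weylSign_eq_one_of_weylAct_rhoW {w : P.weylGroup}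
    (hw : weylAct P w (rhoW b) = rhoW b) : weylSign P w = 1 := by
  have hpos := hθ.corootPairing_rhoW_pos
  obtain ⟨L, hdet, hL⟩ :=
    exists_walk_eq_weylAct b θ (corootPairing P θ (rhoW b) + 1) w
  have hint : InAlcoveInterior b θ (corootPairing P θ (rhoW b) + 1) (rhoW b) :=
    ⟨fun i hi => by rw [corootPairing_rhoW b hi]; exact zero_lt_one, lt_add_one _⟩
  have h := (walk_eq_self_of_inAlcove b θ _ hθ (by lia) L hint.inAlcove
    (by rw [← hL, hw]; exact hint.inAlcove)).2 hint
  rw [weylSign, detSign_eq_neg_one_pow hdet, h.neg_one_pow]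

/-- The coefficient of `e^ρ` sums the signs over the stabilizer of `ρ`; all are `1`, and the
identity contributes. -/
theorem antisymm_chr_rhoW_ne_zero : antisymm P (chr P (rhoW b)) ≠ 0 := by
  classical
  intro h
  have h1 := congrArg (fun f : RT P => f.coeff (rhoW b)) h
  simp only [antisymm_eq_sum, weylActRT_chr, AddMonoidAlgebra.coeff_sum,
    AddMonoidAlgebra.coeff_smul, coeff_chr, Finsupp.finsetSum_apply,
    Finsupp.smul_apply, AddMonoidAlgebra.coeff_zero, Finsupp.coe_zero, Pi.zero_apply] at h1
  have hnonneg : ∀ w ∈ Finset.univ, 0 ≤ weylSign P w •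
      (Finsupp.single (weylAct P w (rhoW b)) (1 : ℤ)) (rhoW b) := fun w _ => by
    by_cases hw : weylAct P w (rhoW b) = rhoW b
    · rw [weylSign_eq_one_of_weylAct_rhoW hθ hw, hw]; simp
    · rw [Finsupp.single_eq_of_ne (Ne.symm hw), smul_zero]
  have h2 := (Finset.sum_eq_zero_iff_of_nonneg hnonneg).mp h1 1 (Finset.mem_univ _)
  simp at h2

/-- A Weyl orbit contains only one dominant weight. -/
theorem IsDominant.weylAct_eq {x : weightLattice P} (hx : IsDominant b x) {w : P.weylGroup}
    (hw : IsDominant b (weylAct P w x)) : weylAct P w x = x := by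
  -- Large enough for the closed alcove to contain both dominant weights.
  set m : ℤ := max 1 (max (corootPairing P θ x) (corootPairing P θ (weylAct P w x)))
  obtain ⟨L, -, hL⟩ := exists_walk_eq_weylAct b θ m w
  have h1 : InAlcove b θ m x := ⟨(isDominant_iff b).mp hx, by lia⟩
  have h2 : InAlcove b θ m (weylAct P w x) := ⟨(isDominant_iff b).mp hw, by lia⟩
  rw [hL] at h2 ⊢
  exact (walk_eq_self_of_inAlcove b θ m hθ (by lia) L h1 h2).1

/-- A maximizer of `(ρ, ·)` on the orbit is dominant, and `x` is the only dominant weight there. -/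
theorem IsDominant.weightForm_rhoW_lt {x : weightLattice P} (hx : IsDominant b x)
    {w : P.weylGroup} (hw : weylAct P w x ≠ x) :
    weightForm P (rhoW b) (weylAct P w x) < weightForm P (rhoW b) x := by
  obtain ⟨v, hv⟩ := exists_forall_weightForm_rhoW_le b x
  have hvx := hx.weylAct_eq hθ (isDominant_weylAct_of_forall_le b hv)
  rw [hvx] at hv
  refine lt_of_le_of_ne (hv w) fun h => hw (hx.weylAct_eq hθ ?_)
  exact isDominant_weylAct_of_forall_le b fun u => by rw [h]; exact hv u

omit [P.IsReduced] hθ in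
open Classical in
/-- The sum of the characters in a Weyl orbit is invariant. -/
theorem sum_orbit_mem_RG (x : weightLattice P) :
    ∑ y ∈ Finset.univ.image (fun w => weylAct P w x), chr P y ∈ RG P := by
  rw [mem_RG_iff]
  intro v
  have hinj : Function.Injective (weylAct P v) := fun y z h => by
    rw [← weylAct_inv_weylAct P v y, h, weylAct_inv_weylAct]
  have himage : (Finset.univ.image fun w => weylAct P w x).image (weylAct P v) =
      Finset.univ.image fun w => weylAct P w x := by
    refine Finset.eq_of_subset_of_card_le ?_ (Finset.card_image_of_injective _ hinj).ge
    intro y hy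
    simp only [Finset.mem_image, Finset.mem_univ, true_and, exists_exists_eq_and] at hy ⊢
    obtain ⟨w, rfl⟩ := hy
    exact ⟨v * w, weylAct_mul P v w x⟩
  rw [map_sum]
  simp only [weylActRT_chr]
  conv_rhs => rw [← himage, Finset.sum_image hinj.injOn]

/-- `A e^ρ` divides every `A e^x`, with an invariant quotient. -/
theorem exists_antisymm_chr_rhoW_mul_eq (x : weightLattice P) :
    ∃ f : RG P, antisymm P (chr P (rhoW b)) * f = antisymm P (chr P x) := by
  classical
  induction hn : (weightForm P x x).toNat using Nat.strong_induction_on generalizing x with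
  | _ n ih =>
    obtain ⟨w, hw⟩ := exists_isDominant_weylAct b x
    suffices h : ∃ f : RG P, antisymm P (chr P (rhoW b)) * f = antisymm P (chr P (weylAct P w x)) by
      obtain ⟨f, hf⟩ := h
      refine ⟨weylSign P w • f, ?_⟩
      rw [AddSubgroupClass.coe_zsmul, mul_smul_comm, hf, antisymm_chr_weylAct, smul_smul,
        detSign_mul_self, one_smul]
    rw [← weightForm_weylAct P w] at hn
    generalize weylAct P w x = y at hn hw
    by_cases hy : ∃ i ∈ b.support, corootPairing P i y = 0
    · obtain ⟨i, -, hi⟩ := hy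
      exact ⟨0, by rw [antisymm_chr_eq_zero P hi]; simp⟩
    push Not at hy
    obtain ⟨z, rfl⟩ : ∃ z, y = z + rhoW b := ⟨y - rhoW b, by abel⟩
    have hz : IsDominant b z := by
      rw [isDominant_iff] at hw ⊢
      intro i hi
      have h1 := hw i hi
      have h2 := hy i hi
      rw [map_add, corootPairing_rhoW b hi] at h1 h2
      lia
    obtain ⟨O, hO, hORG⟩ : ∃ O : Finset (weightLattice P),
        (∀ y, y ∈ O ↔ ∃ w, weylAct P w z = y) ∧ ∑ y ∈ O, chr P y ∈ RG P :=
      ⟨_, fun y => by simp, sum_orbit_mem_RG z⟩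
    have hzO : z ∈ O := (hO z).mpr ⟨1, weylAct_one P z⟩
    have hlt : ∀ u ∈ O.erase z, ∃ f : RG P,
        antisymm P (chr P (rhoW b)) * f = antisymm P (chr P (u + rhoW b)) := fun u hu => by
      obtain ⟨hne, hu⟩ := Finset.mem_erase.mp hu
      obtain ⟨v, rfl⟩ := (hO u).mp hu
      -- `|vz + ρ| < |z + ρ|`, since `|vz| = |z|` and `(ρ, vz) < (ρ, z)`.
      refine ih _ ?_ (weylAct P v z + rhoW b) rfl
      have h1 := hz.weightForm_rhoW_lt hθ hne
      have h2 := weightForm_self_nonneg P (weylAct P v z + rhoW b)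
      have h3 : weightForm P (weylAct P v z + rhoW b) (weylAct P v z + rhoW b) <
          weightForm P (z + rhoW b) (z + rhoW b) := by
        simp only [weightForm_add_left, weightForm_add_right, weightForm_weylAct,
          weightForm_comm P _ (rhoW b)]
        linarith
      lia
    choose! f hf using hlt
    refine ⟨⟨_, hORG⟩ - ∑ u ∈ O.erase z, f u, ?_⟩
    have hsum : antisymm P (chr P (rhoW b)) * ∑ u ∈ O, chr P u =
        ∑ u ∈ O, antisymm P (chr P (u + rhoW b)) := by
      rw [mul_comm, ← antisymm_mul_of_mem_RG hORG, Finset.sum_mul, map_sum]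
      simp only [chr_add]
    rw [AddSubgroupClass.coe_sub, AddSubmonoidClass.coe_finsetSum, mul_sub, hsum,
      Finset.mul_sum, Finset.sum_congr rfl hf, ← Finset.add_sum_erase _ _ hzO, add_sub_cancel_right]

theorem antisymm_chr_rhoW_mul_ind_chr (x : weightLattice P) :
    antisymm P (chr P (rhoW b)) * (ind b (chr P x) : RT P) =
      antisymm P (chr P (x + rhoW b)) := by
  have h := exists_antisymm_chr_rhoW_mul_eq hθ (x + rhoW b)
  rw [ind, liftRT_chr, indChar, dif_pos h]
  exact h.choose_spec

theorem antisymm_chr_rhoW_mul_ind (f : RT P) :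
    antisymm P (chr P (rhoW b)) * (ind b f : RT P) = antisymm P (chr P (rhoW b) * f) := by
  have h : ((AddMonoidHom.mulLeft (antisymm P (chr P (rhoW b)))).comp
      (RG P).subtype.toAddMonoidHom).comp (ind b) =
      (antisymm P).comp (AddMonoidHom.mulLeft (chr P (rhoW b))) := by
    refine addHom_ext_chr P fun x => ?_
    refine (antisymm_chr_rhoW_mul_ind_chr hθ x).trans ?_
    rw [add_comm, chr_add]
    rfl
  exact DFunLike.congr_fun h f

theorem ind_eq_of_antisymm_eq {f : RT P} {g : RG P}
    (h : antisymm P (chr P (rhoW b) * f) = antisymm P (chr P (rhoW b)) * g) : ind b f = g := by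
  have := isDomain_RT P
  rw [← antisymm_chr_rhoW_mul_ind hθ] at h
  exact Subtype.ext (mul_left_cancel₀ (antisymm_chr_rhoW_ne_zero hθ) h)

/-- `A` is `R(G)`-linear, so `A(e^ρ g) = A(e^ρ) g`. Thus `I` is a projection onto `R(G)`, which
forces the shape of `J`. -/
theorem ind_coe (g : RG P) : ind b (g : RT P) = g := by
  refine ind_eq_of_antisymm_eq hθ ?_
  rw [mul_comm, antisymm_mul_of_mem_RG g.2, mul_comm]

theorem ind_chr_weylAct (w : P.weylGroup) {x y : weightLattice P}
    (h : y + rhoW b = weylAct P w (x + rhoW b)) :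
    ind b (chr P y) = weylSign P w • ind b (chr P x) := by
  refine ind_eq_of_antisymm_eq hθ ?_
  rw [← chr_add, add_comm, h, antisymm_chr_weylAct, AddSubgroupClass.coe_zsmul, mul_smul_comm,
    antisymm_chr_rhoW_mul_ind_chr hθ]

end CharacterFormula

/-! ### Transport of a ring structure along a surjection -/

section Transfer

variable {A B : Type*} [CommRing A] [inst : AddCommGroup B] (J : A →+ B)

/-- The ring structure transported along a surjective additive map whose kernel is an ideal. -/
@[reducible]
def commRingOfSurjective (hJ : Function.Surjective J) (hker : ∀ f g, J f = 0 → J (g * f) = 0) :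
    CommRing B :=
  -- The product of classes does not depend on the chosen lifts; every ring axiom then reduces to
  -- the one in `A`.
  have hmul : ∀ f g, J (Function.surjInv hJ (J f) * Function.surjInv hJ (J g)) = J (f * g) := by
    have h : ∀ f f' g, J f = J f' → J (g * f) = J (g * f') := fun f f' g hf => by
      rw [← sub_eq_zero, ← map_sub, ← mul_sub]
      exact hker _ _ (by rw [map_sub, hf, sub_self])
    intro f g
    rw [h _ g _ (Function.surjInv_eq hJ _), mul_comm, h _ f _ (Function.surjInv_eq hJ _), mul_comm]
  -- Keeping `inst` makes `add_eq` in `IsFusionRing` hold by `rfl`.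
  { inst with
    mul := fun a b => J (Function.surjInv hJ a * Function.surjInv hJ b)
    one := J 1
    left_distrib := fun a b c => by
      obtain ⟨a, rfl⟩ := hJ a
      obtain ⟨b, rfl⟩ := hJ b
      obtain ⟨c, rfl⟩ := hJ c
      change J (_ * Function.surjInv hJ (J b + J c)) = J _ + J _
      rw [← map_add J b c, hmul, hmul, hmul, mul_add, map_add]
    right_distrib := fun a b c => by
      obtain ⟨a, rfl⟩ := hJ a
      obtain ⟨b, rfl⟩ := hJ b
      obtain ⟨c, rfl⟩ := hJ c
      change J (Function.surjInv hJ (J a + J b) * _) = J _ + J _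
      rw [← map_add J a b, hmul, hmul, hmul, add_mul, map_add]
    zero_mul := fun a => by
      obtain ⟨a, rfl⟩ := hJ a
      change J (Function.surjInv hJ 0 * _) = 0
      rw [← map_zero J, hmul, zero_mul]
    mul_zero := fun a => by
      obtain ⟨a, rfl⟩ := hJ a
      change J (_ * Function.surjInv hJ 0) = 0
      rw [← map_zero J, hmul, mul_zero]
    mul_assoc := fun a b c => by
      obtain ⟨a, rfl⟩ := hJ a
      obtain ⟨b, rfl⟩ := hJ b
      obtain ⟨c, rfl⟩ := hJ c
      change J (Function.surjInv hJ (J (_ * _)) * _) = J (_ * Function.surjInv hJ (J (_ * _)))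
      rw [hmul a b, hmul b c, hmul, hmul, mul_assoc]
    one_mul := fun a => by
      obtain ⟨a, rfl⟩ := hJ a
      change J (Function.surjInv hJ (J 1) * _) = J a
      rw [hmul, one_mul]
    mul_one := fun a => by
      obtain ⟨a, rfl⟩ := hJ a
      change J (_ * Function.surjInv hJ (J 1)) = J a
      rw [hmul, mul_one]
    mul_comm := fun a b => by
      change J _ = J _
      rw [mul_comm] }

theorem commRingOfSurjective_mul (hJ : Function.Surjective J)
    (hker : ∀ f g, J f = 0 → J (g * f) = 0) (f g : A) :
    J (f * g) = (commRingOfSurjective J hJ hker).mul (J f) (J g) := by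
  have h : ∀ f f' g, J f = J f' → J (g * f) = J (g * f') := fun f f' g hf => by
    rw [← sub_eq_zero, ← map_sub, ← mul_sub]
    exact hker _ _ (by rw [map_sub, hf, sub_self])
  change _ = J (Function.surjInv hJ (J f) * Function.surjInv hJ (J g))
  rw [h _ g _ (Function.surjInv_eq hJ _), mul_comm, h f _ g (Function.surjInv_eq hJ _).symm,
    mul_comm]

end Transfer

/-! ### The map `Ī`, its kernel, and the fusion ring -/

section LoopInduction

variable {ι K M N : Type*} [Field K] [CharZero K] [Fintype ι]
  [AddCommGroup M] [Module K M] [AddCommGroup N] [Module K N]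
  {P : RootPairing ι K M N} [P.IsCrystallographic] [P.IsReduced] [P.IsRootSystem]
  {b : P.Base} {θ : ι} {k : ℕ}

instance instIsAddTorsionFreeRk : IsAddTorsionFree (Rk b θ k) :=
  inferInstanceAs (IsAddTorsionFree (levelWeights b θ k →₀ ℤ))

theorem detSign_linear_mul {v w : M ≃ᵃ[K] M} (hv : v ∈ affineWeyl b θ k)
    (hw : w ∈ affineWeyl b θ k) :
    detSign ((v * w).linear : M →ₗ[K] M) =
      detSign (v.linear : M →ₗ[K] M) * detSign (w.linear : M →ₗ[K] M) := by
  obtain ⟨L, hL⟩ := exists_actsAsWalk_of_mem_affineWeyl b θ k hv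
  obtain ⟨L', hL'⟩ := exists_actsAsWalk_of_mem_affineWeyl b θ k hw
  rw [(hL.mul hL').detSign_eq, hL.detSign_eq, hL'.detSign_eq, List.length_append, pow_add]

variable (b θ k) in
/-- The group homomorphism `R_k(LG) → R(T)` that takes the class of an irreducible representation
to the character of its highest weight. -/
def highestWeightChr : Rk b θ k →+ RT P :=
  Finsupp.liftAddHom (α := levelWeights b θ k) (M := ℤ) fun x => zmultiplesHom (RT P) (chr P x)

theorem highestWeightChr_irr (x : levelWeights b θ k) :
    highestWeightChr b θ k (irr b θ k x) = chr P x := by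
  change Finsupp.liftAddHom (α := levelWeights b θ k) (M := ℤ)
    (fun x => zmultiplesHom (RT P) (chr P x)) (Finsupp.single x 1) = _
  rw [Finsupp.liftAddHom_apply_single]
  simp

theorem addHom_ext_irr {A : Type*} [AddCommGroup A] {f g : Rk b θ k →+ A}
    (h : ∀ x, f (irr b θ k x) = g (irr b θ k x)) : f = g :=
  Finsupp.addHom_ext' (α := levelWeights b θ k) (M := ℤ) fun x => AddMonoidHom.ext_int (h x)

theorem indLoop_chr_eq_zero {x : weightLattice P}
    (h : ∀ w ∈ affineWeyl b θ k, ∀ y ∈ levelWeights b θ k,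
      (x : M) + rho b ≠ w ((y : M) + rho b)) : indLoop b θ k (chr P x) = 0 := by
  rw [indLoop, liftRT_chr, indLoopChar, dif_neg]
  rintro ⟨⟨w, y⟩, hp⟩
  exact h w w.2 y y.2 hp

variable (hθ : IsHighest b θ)
include hθ

theorem shiftedLevel_pos : 0 < shiftedLevel b θ k := by
  have := hθ.corootPairing_rhoW_pos
  rw [shiftedLevel]
  lia

/-- The shifted level weights lie in different orbits of the affine Weyl group, and their stabilizers
contain only elements of sign `1`. -/
theorem eq_and_detSign_eq_one_of_mem_affineWeyl {w : M ≃ᵃ[K] M} (hw : w ∈ affineWeyl b θ k)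
    {x y : weightLattice P} (hx : x ∈ levelWeights b θ k) (hy : y ∈ levelWeights b θ k)
    (h : (y : M) + rho b = w ((x : M) + rho b)) :
    y = x ∧ detSign (w.linear : M →ₗ[K] M) = 1 := by
  obtain ⟨L, hL⟩ := exists_actsAsWalk_of_mem_affineWeyl b θ k hw
  rw [mem_levelWeights_iff] at hx hy
  have hyx : y + rhoW b = walk b θ (shiftedLevel b θ k) L (x + rhoW b) :=
    Subtype.ext (h.trans (hL.2 (x + rhoW b)))
  obtain ⟨h1, h2⟩ := walk_eq_self_of_inAlcove b θ _ hθ (shiftedLevel_pos hθ) L hx.inAlcove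
    (hyx ▸ hy.inAlcove)
  rw [h1] at hyx
  exact ⟨add_right_cancel hyx, by rw [hL.detSign_eq, (h2 hx).neg_one_pow]⟩

/-- Independence of the choice in `indLoopChar`: if `v (z + ρ) = w (y + ρ)`, then `w⁻¹ v` maps `z +
ρ` to `y + ρ`, so `z = y` and `w⁻¹ v` has sign `1`. -/
theorem indLoop_chr_eq {x : weightLattice P} {w : M ≃ᵃ[K] M} (hw : w ∈ affineWeyl b θ k)
    (y : levelWeights b θ k)
    (h : (x : M) + rho b = w (((y : weightLattice P) : M) + rho b)) :
    indLoop b θ k (chr P x) = detSign (w.linear : M →ₗ[K] M) • irr b θ k y := by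
  have hex : ∃ p : affineWeyl b θ k × levelWeights b θ k,
      (x : M) + rho b = (p.1 : M ≃ᵃ[K] M) (((p.2 : weightLattice P) : M) + rho b) :=
    ⟨(⟨w, hw⟩, y), h⟩
  rw [indLoop, liftRT_chr, indLoopChar, dif_pos hex]
  have hspec := hex.choose_spec
  generalize hex.choose = p at hspec ⊢
  obtain ⟨⟨v, hv⟩, z⟩ := p
  have hyz : ((y : weightLattice P) : M) + rho b =
      (w⁻¹ * v) (((z : weightLattice P) : M) + rho b) := by
    change _ = w⁻¹ (v _)
    rw [← hspec, h]
    exact (w.symm_apply_apply _).symm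
  obtain ⟨h1, h2⟩ := eq_and_detSign_eq_one_of_mem_affineWeyl hθ (mul_mem (inv_mem hw) hv)
    z.2 y.2 hyz
  have h3 := detSign_linear_mul hw (mul_mem (inv_mem hw) hv)
  rw [h2, mul_one, mul_inv_cancel_left] at h3
  rw [Subtype.ext h1, ← h3]

theorem indLoop_chr_levelWeight (x : levelWeights b θ k) :
    indLoop b θ k (chr P x) = irr b θ k x := by
  rw [indLoop_chr_eq hθ (one_mem _) x rfl]
  exact (congrArg (· • irr b θ k x) detSign_id).trans (one_smul ℤ _)

theorem indLoop_chr_affineWeyl {w : M ≃ᵃ[K] M} (hw : w ∈ affineWeyl b θ k)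
    {x y : weightLattice P} (h : (y : M) + rho b = w ((x : M) + rho b)) :
    indLoop b θ k (chr P y) = detSign (w.linear : M →ₗ[K] M) • indLoop b θ k (chr P x) := by
  by_cases hx : ∃ v ∈ affineWeyl b θ k, ∃ z ∈ levelWeights b θ k,
      (x : M) + rho b = v ((z : M) + rho b)
  · obtain ⟨v, hv, z, hz, hxz⟩ := hx
    rw [indLoop_chr_eq hθ hv ⟨z, hz⟩ hxz, smul_smul, ← detSign_linear_mul hw hv]
    refine indLoop_chr_eq hθ (mul_mem hw hv) ⟨z, hz⟩ ?_
    rw [h, hxz]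
    rfl
  · push Not at hx
    rw [indLoop_chr_eq_zero hx, smul_zero]
    refine indLoop_chr_eq_zero fun v hv z hz hyz => hx (w⁻¹ * v) (mul_mem (inv_mem hw) hv) z hz ?_
    change _ = w⁻¹ (v _)
    rw [← hyz, h]
    exact (w.symm_apply_apply _).symm

theorem indLoop_chr_weylAct (w : P.weylGroup) {x y : weightLattice P}
    (h : y + rhoW b = weylAct P w (x + rhoW b)) :
    indLoop b θ k (chr P y) = weylSign P w • indLoop b θ k (chr P x) := by
  obtain ⟨L, hdet, hL⟩ := exists_walk_eq_weylAct b θ (shiftedLevel b θ k) w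
  obtain ⟨v, hv, hvL⟩ := exists_mem_affineWeyl_actsAsWalk b θ k L
  rw [weylSign, detSign_eq_neg_one_pow hdet, ← hvL.detSign_eq]
  refine indLoop_chr_affineWeyl hθ hv ?_
  rw [hL] at h
  exact (congrArg Subtype.val h).trans (hvL.2 (x + rhoW b)).symm

omit hθ in
/-- A weight that is not conjugate to a level weight is fixed by a transformation of sign `-1`. -/
theorem chr_mem_affineRelations {x : weightLattice P}
    (h : ∀ w ∈ affineWeyl b θ k, ∀ y ∈ levelWeights b θ k,
      (x : M) + rho b ≠ w ((y : M) + rho b)) : chr P x ∈ affineRelations b θ k := by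
  have hm : corootPairing P θ (rhoW b) < shiftedLevel b θ k := by rw [shiftedLevel]; lia
  obtain ⟨L, hL⟩ := exists_inAlcove_walk b θ _ hm (x + rhoW b)
  by_cases hint : InAlcoveInterior b θ (shiftedLevel b θ k)
      (walk b θ (shiftedLevel b θ k) L (x + rhoW b))
  · exfalso
    obtain ⟨w, hw, hwL⟩ := exists_mem_affineWeyl_actsAsWalk b θ k L.reverse
    refine h w hw (walk b θ (shiftedLevel b θ k) L (x + rhoW b) - rhoW b) ?_ ?_
    · rwa [mem_levelWeights_iff, sub_add_cancel]
    · have h1 := hwL.2 (walk b θ (shiftedLevel b θ k) L (x + rhoW b))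
      rw [walk_reverse_walk] at h1
      rw [AddSubgroup.coe_sub, coe_rhoW, sub_add_cancel, h1]
      rfl
  · obtain ⟨i, hi⟩ := exists_wallReflection_eq_self_of_inAlcove b θ _ hL hint
    -- The wall reflection fixing the endpoint, conjugated back to `x + ρ`: a word of odd length.
    obtain ⟨w, hw, hwL⟩ := exists_mem_affineWeyl_actsAsWalk b θ k (L.reverse ++ i :: L)
    refine AddSubgroup.subset_closure (Or.inr ⟨w, hw, x, ?_, ?_, rfl⟩)
    · have h1 := hwL.2 (x + rhoW b)
      rw [walk_append, walk_cons, hi, walk_reverse_walk] at h1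
      exact h1.symm
    · rw [hwL.detSign_eq, List.length_append, List.length_reverse, List.length_cons, ← add_assoc,
        pow_succ, (Even.add_self L.length).neg_one_pow, one_mul]

/-- Modulo the relations, each `e^x` agrees with the lift of `Ī(e^x)` by `highestWeightChr`, so `Ī f
= 0` makes `f` a relation. For the converse, a weight fixed with sign `-1` has an image equal to its
own negative. -/
theorem ker_indLoop : (indLoop b θ k).ker = affineRelations b θ k := by
  apply le_antisymm
  · have h : (QuotientAddGroup.mk' (affineRelations b θ k)).comp
        ((highestWeightChr b θ k).comp (indLoop b θ k)) =
        QuotientAddGroup.mk' (affineRelations b θ k) := by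
      refine addHom_ext_chr P fun x => ?_
      refine (QuotientAddGroup.eq.mpr ?_)
      rw [neg_add_eq_sub]
      change chr P x - highestWeightChr b θ k (indLoop b θ k (chr P x)) ∈ _
      by_cases hx : ∃ v ∈ affineWeyl b θ k, ∃ z ∈ levelWeights b θ k,
          (x : M) + rho b = v ((z : M) + rho b)
      · obtain ⟨v, hv, z, hz, hxz⟩ := hx
        rw [indLoop_chr_eq hθ hv ⟨z, hz⟩ hxz, map_zsmul, highestWeightChr_irr]
        exact AddSubgroup.subset_closure (Or.inl ⟨v, hv, z, x, hxz, rfl⟩)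
      · push Not at hx
        rw [indLoop_chr_eq_zero hx, map_zero, sub_zero]
        exact chr_mem_affineRelations hx
    intro f hf
    have h1 := DFunLike.congr_fun h f
    rw [AddMonoidHom.comp_apply, AddMonoidHom.comp_apply, hf, map_zero, map_zero] at h1
    exact (QuotientAddGroup.eq_zero_iff f).mp h1.symm
  · rw [affineRelations, AddSubgroup.closure_le]
    rintro _ (⟨w, hw, x, y, hxy, rfl⟩ | ⟨w, hw, x, hx, hsign, rfl⟩)
    · rw [SetLike.mem_coe, AddMonoidHom.mem_ker, map_sub, map_zsmul,
        indLoop_chr_affineWeyl hθ hw hxy, sub_self]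
    · have h := indLoop_chr_affineWeyl hθ hw hx
      rw [hsign, neg_one_smul] at h
      exact self_eq_neg.mp h

/-- The sign of `w` in `A` cancels the one from the shifted action, so all `|W|` terms contribute
the same `Ī(e^x)`. -/
theorem card_smul_indLoop (f : RT P) :
    Fintype.card P.weylGroup • indLoop b θ k f =
      indLoop b θ k (chr P (-rhoW b) * antisymm P (chr P (rhoW b) * f)) := by
  have h : Fintype.card P.weylGroup • indLoop b θ k =
      (indLoop b θ k).comp ((AddMonoidHom.mulLeft (chr P (-rhoW b))).comp
        ((antisymm P).comp (AddMonoidHom.mulLeft (chr P (rhoW b))))) := by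
    refine addHom_ext_chr P fun x => ?_
    change _ = indLoop b θ k (chr P (-rhoW b) * antisymm P (chr P (rhoW b) * chr P x))
    rw [← chr_add, antisymm_eq_sum, Finset.mul_sum, map_sum]
    have h1 : ∀ w, indLoop b θ k (chr P (-rhoW b) *
        weylSign P w • weylActRT P w (chr P (rhoW b + x))) = indLoop b θ k (chr P x) := fun w => by
      rw [weylActRT_chr, mul_smul_comm, ← chr_add, map_zsmul, indLoop_chr_weylAct hθ w (x := x),
        smul_smul, detSign_mul_self, one_smul]
      rw [add_comm x]
      abel
    rw [Finset.sum_congr rfl fun w _ => h1 w, Finset.sum_const]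
    rfl
  exact DFunLike.congr_fun h f

theorem indLoop_eq_zero_of_ind_eq_zero {f : RT P} (hf : ind b f = 0) : indLoop b θ k f = 0 := by
  have h := card_smul_indLoop (k := k) hθ f
  rw [← antisymm_chr_rhoW_mul_ind hθ, hf, ZeroMemClass.coe_zero, mul_zero, mul_zero, map_zero] at h
  exact (smul_eq_zero_iff_right Fintype.card_ne_zero).mp h

/-- `f` and `I(f)` have the same image under the projection `I`, and `Ī` vanishes on its kernel. -/
theorem indLoop_ind (f : RT P) : indLoop b θ k (ind b f : RT P) = indLoop b θ k f := by
  rw [← sub_eq_zero, ← map_sub]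
  refine indLoop_eq_zero_of_ind_eq_zero hθ ?_
  rw [map_sub, ind_coe hθ, sub_self]

/-- If `w` has linear part `v`, then `w (z + (x + ρ)) = v z + w (x + ρ)`. For invariant `g` the
twist by `v` disappears, so multiplication by `g` preserves the affine relations. -/
theorem indLoop_weylActRT_mul_chr {w : M ≃ᵃ[K] M} (hw : w ∈ affineWeyl b θ k)
    {v : P.weylGroup} (hv : ∀ x : M, w.linear x = v • x) {x y : weightLattice P}
    (h : (y : M) + rho b = w ((x : M) + rho b)) (g : RT P) :
    indLoop b θ k (weylActRT P v g * chr P y) =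
      detSign (w.linear : M →ₗ[K] M) • indLoop b θ k (g * chr P x) := by
  have key : (indLoop b θ k).comp ((AddMonoidHom.mulRight (chr P y)).comp
        (weylActRT P v).toAddMonoidHom) =
      detSign (w.linear : M →ₗ[K] M) • (indLoop b θ k).comp (AddMonoidHom.mulRight (chr P x)) := by
    refine addHom_ext_chr P fun z => ?_
    change indLoop b θ k (weylActRT P v (chr P z) * chr P y) =
      detSign (w.linear : M →ₗ[K] M) • indLoop b θ k (chr P z * chr P x)
    rw [weylActRT_chr, ← chr_add, ← chr_add]
    refine indLoop_chr_affineWeyl hθ hw ?_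
    have h1 := w.map_vadd ((x : M) + rho b) (z : M)
    rw [vadd_eq_add, vadd_eq_add, hv, ← h] at h1
    rw [AddSubgroup.coe_add, AddSubgroup.coe_add, add_assoc, add_assoc, h1]
    rfl
  exact DFunLike.congr_fun key g

theorem indLoop_mul_eq_zero {g f : RT P} (hg : g ∈ RG P) (hf : indLoop b θ k f = 0) :
    indLoop b θ k (g * f) = 0 := by
  rw [← AddMonoidHom.mem_ker, ker_indLoop hθ] at hf
  induction hf using AddSubgroup.closure_induction with
  | mem f hf =>
    rcases hf with ⟨w, hw, x, y, hxy, rfl⟩ | ⟨w, hw, x, hx, hsign, rfl⟩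
    · obtain ⟨v, hv⟩ := exists_linear_eq_of_mem_affineWeyl b θ k hw
      have h := indLoop_weylActRT_mul_chr hθ hw hv hxy g
      rw [(mem_RG_iff P).mp hg] at h
      rw [mul_sub, mul_smul_comm, map_sub, map_zsmul, h, sub_self]
    · obtain ⟨v, hv⟩ := exists_linear_eq_of_mem_affineWeyl b θ k hw
      have h := indLoop_weylActRT_mul_chr hθ hw hv hx g
      rw [(mem_RG_iff P).mp hg, hsign, neg_one_smul] at h
      exact self_eq_neg.mp h
  | zero => rw [mul_zero, map_zero]
  | add f f' _ _ hf hf' => rw [mul_add, map_add, hf, hf', add_zero]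
  | neg f _ hf => rw [mul_neg, map_neg, hf, neg_zero]

variable (b θ k) in
omit hθ in
/-- The factorization of `Ī` through `I`: the restriction of `Ī` to `R(G)`. -/
def restrictIndLoop : RG P →+ Rk b θ k := (indLoop b θ k).comp (RG P).subtype.toAddMonoidHom

theorem restrictIndLoop_ind (f : RT P) : restrictIndLoop b θ k (ind b f) = indLoop b θ k f :=
  indLoop_ind hθ f

theorem restrictIndLoop_surjective : Function.Surjective (restrictIndLoop b θ k) := fun r => by
  refine ⟨ind b (highestWeightChr b θ k r), ?_⟩
  rw [restrictIndLoop_ind hθ]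
  have h : (indLoop b θ k).comp (highestWeightChr b θ k) = AddMonoidHom.id _ :=
    addHom_ext_irr fun x => by
      rw [AddMonoidHom.comp_apply, highestWeightChr_irr, indLoop_chr_levelWeight hθ]
      rfl
  exact DFunLike.congr_fun h r

theorem ker_restrictIndLoop :
    (restrictIndLoop b θ k).ker = (affineRelations b θ k).map (ind b) := by
  ext g
  rw [AddMonoidHom.mem_ker, AddSubgroup.mem_map, ← ker_indLoop hθ]
  constructor
  · exact fun h => ⟨g, h, ind_coe hθ g⟩
  · rintro ⟨f, hf, rfl⟩
    rw [restrictIndLoop_ind hθ]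
    exact hf

theorem restrictIndLoop_mul_eq_zero (f g : RG P) (hf : restrictIndLoop b θ k f = 0) :
    restrictIndLoop b θ k (g * f) = 0 :=
  indLoop_mul_eq_zero hθ g.2 hf

theorem existsUnique_isFusionRing :
    ∃! F : CommRing (Rk b θ k), IsFusionRing b (restrictIndLoop b θ k) F := by
  have hJ := restrictIndLoop_surjective (k := k) hθ
  have hker := restrictIndLoop_mul_eq_zero (k := k) hθ
  refine ⟨commRingOfSurjective _ hJ hker, ⟨rfl, rfl, commRingOfSurjective_mul _ hJ hker⟩,
    fun F hF => CommRing.ext ?_ ?_⟩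
  · exact congrArg (fun G : AddCommGroup (Rk b θ k) => G.add) hF.add_eq
  -- Surjectivity of `J` forces the product.
  · funext r s
    obtain ⟨f, rfl⟩ := hJ r
    obtain ⟨g, rfl⟩ := hJ s
    exact (hF.map_mul f g).symm.trans (commRingOfSurjective_mul _ hJ hker f g)

end LoopInduction

end

end FusionAlgebra

open FusionAlgebra LieAlgebra.IsKilling in
/-- `𝔤` is the complexified Lie algebra of `G` and `𝔱` that of the maximal torus `T`.  The first
four parts say that `I` and `Ī` are the induction maps described by the Weyl character formula and
the theorem of Borel, Weil and Bott, the fifth describes the kernel of `Ī`, and the last one is about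
the factorization `J` of `Ī` through `I`. -/
theorem lemma2p2 {𝔤 : Type*} [LieRing 𝔤] [LieAlgebra ℂ 𝔤] [FiniteDimensional ℂ 𝔤]
    [LieAlgebra.IsSimple ℂ 𝔤] (𝔱 : LieSubalgebra ℂ 𝔤) [𝔱.IsCartanSubalgebra]
    (b : (rootSystem 𝔱).Base) (θ : 𝔱.root) (hθ : IsHighest b θ) (k : ℕ) :
    -- the Weyl character formula
    (∀ x : weightLattice (rootSystem 𝔱),
      antisymm (rootSystem 𝔱) (chr _ (rhoW b)) * (ind b (chr _ x) : RT (rootSystem 𝔱)) =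
        antisymm (rootSystem 𝔱) (chr _ (x + rhoW b))) ∧
    -- the finite relations
    (∀ (w : (rootSystem 𝔱).weylGroup) (x y : weightLattice (rootSystem 𝔱)),
      y + rhoW b = weylAct _ w (x + rhoW b) →
        ind b (chr _ y) = detSign ((rootSystem 𝔱).weylGroupRootRep w) • ind b (chr _ x)) ∧
    -- dominant weights of level `k`
    (∀ x : levelWeights b θ k, indLoop b θ k (chr _ x) = irr b θ k x) ∧
    -- the affine relations
    (∀ w ∈ affineWeyl b θ k, ∀ x y : weightLattice (rootSystem 𝔱),
      (y : Module.Dual ℂ 𝔱) + rho b = w (x + rho b) →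
        indLoop b θ k (chr _ y) =
          detSign (w.linear : Module.Dual ℂ 𝔱 →ₗ[ℂ] Module.Dual ℂ 𝔱) •
            indLoop b θ k (chr _ x)) ∧
    -- the kernel of `Ī`
    (indLoop b θ k).ker = affineRelations b θ k ∧
    ∃ J : RG (rootSystem 𝔱) →+ Rk b θ k,
      -- `J` is the unique factorization of `Ī` through `I`
      (∀ J' : RG (rootSystem 𝔱) →+ Rk b θ k,
        (∀ f : RT (rootSystem 𝔱), J' (ind b f) = indLoop b θ k f) ↔ J' = J) ∧
      -- the kernel of `J`, given by the affine relations, is an ideal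
      J.ker = (affineRelations b θ k).map (ind b) ∧
      (∃ 𝔞 : Ideal (RG (rootSystem 𝔱)), ∀ f, f ∈ 𝔞 ↔ J f = 0) ∧
      -- the fusion algebra
      ∃! F : CommRing (Rk b θ k), IsFusionRing b J F := by
  refine ⟨antisymm_chr_rhoW_mul_ind_chr hθ, fun w x y h => ind_chr_weylAct hθ w h,
    indLoop_chr_levelWeight hθ, fun w hw x y h => indLoop_chr_affineWeyl hθ hw h, ker_indLoop hθ,
    restrictIndLoop b θ k, fun J' => ⟨fun h => ?_, ?_⟩, ker_restrictIndLoop hθ, ?_,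
    existsUnique_isFusionRing hθ⟩
  · ext1 g
    -- Every `g` in `R(G)` is `I(g)`, so `J'` is determined by `Ī`.
    rw [← ind_coe hθ g, h, restrictIndLoop_ind hθ]
  · rintro rfl
    exact restrictIndLoop_ind hθ
  · exact ⟨{ (restrictIndLoop b θ k).ker with
      smul_mem' := fun g f hf => restrictIndLoop_mul_eq_zero hθ f g hf }, fun f => Iff.rfl⟩
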